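/- **Conventions.** Let $k,N\ge 0$ be integers and let $\mathbb S^k\subset\mathbb R^{k+1}$ be the unit sphere, oriented as the boundary of the unit ball. For $\sigma\in(0,1]$, a map $\varphi:\mathbb S^k\to\mathbb R^N$ is $C^\sigma$ if $|\varphi(x)-\varphi(y)|\le C|x-y|^\sigma$ for some constant $C$ and all $x,y\in\mathbb S^k$. A *smooth $C^\sigma$-approximation* of $\varphi$ is a family of maps $\varphi_\varepsilon:\mathbb S^k\to\mathbb R^N$ such that, as $\varepsilon\to0^+$, * $\varphi_\varepsilon$ is $C^\infty$ for all sufficiently small $\varepsilon>0$, * $\varphi_\varepsilon\to\varphi$ uniformly on $\mathbb S^k$, and * $\varphi_\varepsilon$ is bounded in $C^\sigma$: there is a constant $C$ with $|\varphi_\varepsilon(x)-\varphi_\varepsilon(y)|\le C|x-y|^\sigma$ for all $x,y\in\mathbb S^k$ and all sufficiently small $\varepsilon>0$. (If $\varphi$ is $C^\sigma$, this includes every family of smooth maps that converges to $\varphi$ in the $C^\sigma$-norm.) **Lemma.** Let $\frac{k}{k+1}<\sigma\le 1$, let $\varphi:\mathbb S^k\to\mathbb R^N$ be $C^\sigma$,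 and let $\omega$ be a smooth differential $k$-form on $\mathbb R^N$. Then $\varphi$ has a smooth $C^\sigma$-approximation, and there is a real number $L$ such that every smooth $C^\sigma$-approximation $(\varphi_\varepsilon)$ of $\varphi$ satisfies $$\lim_{\varepsilon\to0^+}\int_{\mathbb S^k}\varphi_\varepsilon^*\omega=L .$$ That is, the limit exists and does not depend on the choice of the approximation. -/

import Mathlib

open MeasureTheory Filter Topology
open scoped ContDiff Manifold NNReal

noncomputable section

/-- The unit sphere `𝕊ᵏ` in Euclidean space `ℝᵏ⁺¹`. -/
abbrev UnitSphere (k : ℕ) : Type :=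
  Metric.sphere (0 : EuclideanSpace ℝ (Fin (k + 1))) 1

/-- The radial retraction `y ↦ y / |y|` of `ℝᵏ⁺¹ \ {0}` onto `𝕊ᵏ`. -/
def radialRetraction {k : ℕ} (y : EuclideanSpace ℝ (Fin (k + 1))) (hy : y ≠ 0) : UnitSphere k :=
  ⟨‖y‖⁻¹ • y, by simp [norm_smul, hy]⟩

open Classical in
/-- The `0`-homogeneous extension `y ↦ ψ (y / |y|)` of a map `ψ` on the sphere to
`ℝᵏ⁺¹ \ {0}` (with the irrelevant value `0` at the origin). -/
def homogeneousExtension {k N : ℕ} (ψ : UnitSphere k → EuclideanSpace ℝ (Fin N))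
    (y : EuclideanSpace ℝ (Fin (k + 1))) : EuclideanSpace ℝ (Fin N) :=
  if hy : y ≠ 0 then ψ (radialRetraction y hy) else 0

/-- The differential of `ψ : 𝕊ᵏ → ℝᴺ` at `x`, as a linear map on all of `ℝᵏ⁺¹ = ℝ x ⊕ T_x 𝕊ᵏ`:
it is the usual differential `dψ_x` on the tangent space `T_x 𝕊ᵏ = x^⊥`, and `0` on the normal
line `ℝ x`. -/
def sphereDifferential {k N : ℕ} (ψ : UnitSphere k → EuclideanSpace ℝ (Fin N)) (x : UnitSphere k) :
    EuclideanSpace ℝ (Fin (k + 1)) →L[ℝ] EuclideanSpace ℝ (Fin N) :=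
  fderiv ℝ (homogeneousExtension ψ) (x : EuclideanSpace ℝ (Fin (k + 1)))

/-- The pullback `ψ^* w` at `x`:
`(v₁, …, v_k) ↦ w_{ψ(x)} (dψ_x v₁, …, dψ_x v_k)`. -/
def spherePullback {k N : ℕ} (ψ : UnitSphere k → EuclideanSpace ℝ (Fin N))
    (w : EuclideanSpace ℝ (Fin N) → EuclideanSpace ℝ (Fin N) [⋀^Fin k]→L[ℝ] ℝ)
    (x : UnitSphere k) : EuclideanSpace ℝ (Fin (k + 1)) [⋀^Fin k]→L[ℝ] ℝ :=
  (w (ψ x)).compContinuousLinearMap (sphereDifferential ψ x)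

/-- The density of a `k`-form `β` at `x ∈ 𝕊ᵏ` with respect to the volume form of `𝕊ᵏ`, oriented as
the boundary of the unit ball (outward normal first). It is the value of `x^♭ ∧ β` on the standard
basis `(e₀, …, e_k)` of `ℝᵏ⁺¹`, that is `∑ᵢ (-1)ⁱ xᵢ β(e₀, …, êᵢ, …, e_k)`; equivalently, it is
`β(v₁, …, v_k)` for any orthonormal basis `(v₁, …, v_k)` of `T_x 𝕊ᵏ` for which
`(x, v₁, …, v_k)` is a positively oriented basis of `ℝᵏ⁺¹`. -/
def sphereDensity {k : ℕ} (x : UnitSphere k)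
    (β : EuclideanSpace ℝ (Fin (k + 1)) [⋀^Fin k]→L[ℝ] ℝ) : ℝ :=
  ∑ i : Fin (k + 1), (-1) ^ (i : ℕ) * (x : EuclideanSpace ℝ (Fin (k + 1))) i *
    β fun j => EuclideanSpace.single (i.succAbove j) 1

/-- The integral `∫_{𝕊ᵏ} ψ^* w` of the pulled back `k`-form over the oriented sphere; `toSphere` is
the surface measure. -/
def spherePullbackIntegral {k N : ℕ} (ψ : UnitSphere k → EuclideanSpace ℝ (Fin N))
    (w : EuclideanSpace ℝ (Fin N) → EuclideanSpace ℝ (Fin N) [⋀^Fin k]→L[ℝ] ℝ) : ℝ :=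
  ∫ x, sphereDensity x (spherePullback ψ w x)
    ∂((volume : Measure (EuclideanSpace ℝ (Fin (k + 1)))).toSphere)

/-- `φε`, for `ε → 0⁺`, is a smooth `C^σ`-approximation of `φ`: the maps are smooth, converge
uniformly to `φ`, and are bounded in `C^σ`. Mollifications are of this kind, and so is, for `φ` in
`C^σ`, every family of smooth maps that converges to `φ` in the `C^σ`-norm. -/
structure IsSmoothHolderApprox {k N : ℕ} (σ : ℝ≥0) (φ : UnitSphere k → EuclideanSpace ℝ (Fin N))
    (φε : ℝ → UnitSphere k → EuclideanSpace ℝ (Fin N)) : Prop where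
  smooth : ∀ᶠ ε in 𝓝[>] (0 : ℝ), ContMDiff (𝓡 k) 𝓘(ℝ, EuclideanSpace ℝ (Fin N)) ∞ (φε ε)
  tendsto : TendstoUniformly φε φ (𝓝[>] (0 : ℝ))
  bounded : ∃ C : ℝ≥0, ∀ᶠ ε in 𝓝[>] (0 : ℝ), HolderWith C σ (φε ε)

end

/-! The key is an integral over `ℝⁿ`, `n = k + 1`, namely `J(f) = ∫ f₀ dχ ∧ df₁ ∧ ⋯ ∧ df_k` with `χ`
a compactly supported cutoff. Integration by parts (`jacPairing_swap`, from the null Lagrangian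
property `integral_jacDet_eq_zero`) moves the derivative off any one factor. So if all gradients are
at most `A`, then `J` changes by at most a constant times `δ A ^ k` when the factors move by `δ` in
the sup norm (`abs_jacPairing_sub_le`).

Mollifying a `C^σ` function at scale `ε` moves it by `O(ε^σ)` and gives gradients of size `O(ε^(σ -
1))`. Between the scales `ε` and `ε / 2` the value of `J` therefore changes by `O(ε^γ)` with `γ = σ
+ k (σ - 1)`, and `γ > 0` is exactly `σ > k / (k + 1)`. The dyadic sum is geometric, so
mollification changes `J` by a small amount, uniformly on bounded sets of `C^σ`. At a fixed scale
`J` is continuous for uniform convergence. Hence `J` is uniformly continuous for uniform convergence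
on bounded sets of `C^σ` (`jacPairing_uniformContinuous_holder`).

The sphere integral is a combination of such pairings: expand `w` in coordinates, extend the scalar
functions `0`-homogeneously near the sphere, and use polar coordinates with `χ` radial
(`spherePullbackIntegral_eq_sum_jacPairing`). The integrals along an approximation are then Cauchy,
and those along two approximations share their limit. -/

/-- The coordinates of the differential of a scalar function on Euclidean space. -/
noncomputable def gradRow {n : ℕ} (f : EuclideanSpace ℝ (Fin n) → ℝ)
    (y : EuclideanSpace ℝ (Fin n)) : Fin n → ℝ :=
  fun c => fderiv ℝ f y (EuclideanSpace.single c 1)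

/-- The Jacobian determinant of `n` scalar functions on `ℝⁿ`; the `i`-th row is the gradient of
`u i`. -/
noncomputable def jacDet {n : ℕ} (u : Fin n → EuclideanSpace ℝ (Fin n) → ℝ)
    (y : EuclideanSpace ℝ (Fin n)) : ℝ :=
  Matrix.det fun i => gradRow (u i) y

/-! ### Jacobian determinants as null Lagrangians -/

section JacobianDeterminant

variable {n : ℕ}

lemma contDiff_gradRow_apply {f : EuclideanSpace ℝ (Fin n) → ℝ} (hf : ContDiff ℝ ∞ f) (c : Fin n) :
    ContDiff ℝ ∞ fun y => gradRow f y c := by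
  unfold gradRow
  have h : ContDiff ℝ ∞ (fderiv ℝ f) := hf.fderiv_right (by simp)
  exact h.clm_apply contDiff_const

lemma contDiff_gradRow {f : EuclideanSpace ℝ (Fin n) → ℝ} (hf : ContDiff ℝ ∞ f) :
    ContDiff ℝ ∞ (gradRow f) :=
  contDiff_pi.2 fun c => contDiff_gradRow_apply hf c

/-- The determinant as a continuous multilinear function of the rows. -/
noncomputable def detRowCMM (n : ℕ) :
    ContinuousMultilinearMap ℝ (fun _ : Fin n => Fin n → ℝ) ℝ where
  toMultilinearMap := (Matrix.detRowAlternating (n := Fin n) (R := ℝ)).toMultilinearMap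
  cont := by
    have : Continuous fun M : Matrix (Fin n) (Fin n) ℝ => M.det := continuous_id.matrix_det
    exact this

lemma detRowCMM_apply (M : Fin n → Fin n → ℝ) : detRowCMM n M = Matrix.det M := rfl

lemma contDiff_det_rows {r : Fin n → EuclideanSpace ℝ (Fin n) → (Fin n → ℝ)}
    (hr : ∀ i, ContDiff ℝ ∞ (r i)) : ContDiff ℝ ∞ fun y => Matrix.det fun i => r i y :=
  (detRowCMM n).contDiff.comp (contDiff_pi.2 hr)

lemma contDiff_jacDet {u : Fin n → EuclideanSpace ℝ (Fin n) → ℝ} (hu : ∀ i, ContDiff ℝ ∞ (u i)) :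
    ContDiff ℝ ∞ (jacDet u) :=
  contDiff_det_rows fun i => contDiff_gradRow (hu i)

lemma jacDet_update (u : Fin n → EuclideanSpace ℝ (Fin n) → ℝ) (i : Fin n)
    (h : EuclideanSpace ℝ (Fin n) → ℝ) (y : EuclideanSpace ℝ (Fin n)) :
    jacDet (Function.update u i h) y =
      Matrix.det (Function.update (fun j => gradRow (u j) y) i (gradRow h y)) := by
  unfold jacDet
  congr 1
  funext j
  by_cases hj : j = i
  · subst hj; simp
  · simp [hj]

lemma det_update_row_eq_sum (M : Fin n → Fin n → ℝ) (i : Fin n) (v : Fin n → ℝ) :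
    Matrix.det (Function.update M i v) =
      ∑ c, v c * Matrix.det (Function.update M i (Pi.single c 1)) := by
  have h := (detRowCMM n).toMultilinearMap.map_update_sum Finset.univ i
    (fun c => v c • (Pi.single c 1 : Fin n → ℝ)) M
  have hv : (∑ c, v c • (Pi.single c 1 : Fin n → ℝ)) = v := by
    ext d; simp [Finset.sum_apply, Pi.single_apply]
  rw [hv] at h
  refine h.trans (Finset.sum_congr rfl fun c _ => ?_)
  rw [MultilinearMap.map_update_smul]
  rfl

lemma gradRow_fderiv_symm {f : EuclideanSpace ℝ (Fin n) → ℝ} (hf : ContDiff ℝ ∞ f)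
    (y : EuclideanSpace ℝ (Fin n)) (c d : Fin n) :
    fderiv ℝ (fun z => gradRow f z d) y (EuclideanSpace.single c 1) =
      fderiv ℝ (fun z => gradRow f z c) y (EuclideanSpace.single d 1) := by
  have h1 : DifferentiableAt ℝ (fderiv ℝ f) y :=
    ((hf.fderiv_right (m := 1) (by norm_cast)).differentiable one_ne_zero).differentiableAt
  have key : ∀ a b : Fin n, fderiv ℝ (fun z => gradRow f z a) y (EuclideanSpace.single b 1) =
      fderiv ℝ (fderiv ℝ f) y (EuclideanSpace.single b 1) (EuclideanSpace.single a 1) := by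
    intro a b
    unfold gradRow
    rw [fderiv_clm_apply h1 (by fun_prop)]
    simp
  rw [key, key]
  have hs : IsSymmSndFDerivAt ℝ f y := hf.contDiffAt.isSymmSndFDerivAt
    (by rw [minSmoothness_of_isRCLikeNormedField]; exact WithTop.coe_le_coe.2 le_top)
  exact hs _ _

/-- The cofactors of the gradient of `u i₀` in a Jacobian determinant form a divergence-free vector
field. -/
lemma sum_fderiv_cofactor_eq_zero {u : Fin n → EuclideanSpace ℝ (Fin n) → ℝ}
    (hu : ∀ i, ContDiff ℝ ∞ (u i)) (i₀ : Fin n) (y : EuclideanSpace ℝ (Fin n)) :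
    ∑ c, fderiv ℝ (fun z => Matrix.det (Function.update (fun j => gradRow (u j) z) i₀
      (Pi.single c 1))) y (EuclideanSpace.single c 1) = 0 := by
  -- `r c` lists the rows of the `c`-th cofactor: gradients, except for the constant row `e_c` in
  -- position `i₀`. Its determinant is differentiated row by row.
  let r : Fin n → Fin n → EuclideanSpace ℝ (Fin n) → (Fin n → ℝ) := fun c j =>
    if j = i₀ then fun _ => Pi.single c 1 else gradRow (u j)
  have hr : ∀ c j, ContDiff ℝ ∞ (r c j) := by
    intro c j
    by_cases hj : j = i₀
    · simp only [r, hj, if_true]; exact contDiff_const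
    · simp only [r, hj, if_false]; exact contDiff_gradRow (hu j)
  have hrow : ∀ c z, Function.update (fun j => gradRow (u j) z) i₀ (Pi.single c 1) =
      fun j => r c j z := by
    intro c z
    funext j
    by_cases hj : j = i₀
    · subst hj; simp [r]
    · simp [r, hj]
  have hder : ∀ c, fderiv ℝ (fun z => Matrix.det (Function.update (fun j => gradRow (u j) z) i₀
      (Pi.single c 1))) y (EuclideanSpace.single c 1) =
      ∑ j, Matrix.det (Function.update (fun l => r c l y) j
        (fderiv ℝ (r c j) y (EuclideanSpace.single c 1))) := by
    intro c
    simp_rw [hrow]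
    have := HasFDerivAt.multilinear_comp (f := detRowCMM n) (g := r c)
      (g' := fun j => fderiv ℝ (r c j) y) (x := y)
      (fun j => ((hr c j).differentiable (by simp)).differentiableAt.hasFDerivAt)
    simp_rw [detRowCMM_apply] at this
    rw [this.fderiv]
    simp [ContinuousMultilinearMap.toContinuousLinearMap, detRowCMM_apply]
  simp_rw [hder]
  rw [Finset.sum_comm]
  refine Finset.sum_eq_zero fun j _ => ?_
  by_cases hj : j = i₀
  · subst hj
    refine Finset.sum_eq_zero fun c _ => ?_
    have : fderiv ℝ (r c j) y = 0 := by
      simp only [r, if_true]; exact (hasFDerivAt_const _ _).fderiv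
    rw [this]
    exact (detRowCMM n).toMultilinearMap.map_update_zero _ _
  · have hrow' : ∀ c, (fun l => r c l y) =
        Function.update (fun l => gradRow (u l) y) i₀ (Pi.single c 1) := fun c => (hrow c y).symm
    have hd : ∀ c d, (fderiv ℝ (r c j) y (EuclideanSpace.single c 1)) d =
        fderiv ℝ (fun z => gradRow (u j) z d) y (EuclideanSpace.single c 1) := by
      intro c d
      simp only [r, hj, if_false]
      have h := (((contDiff_gradRow (hu j)).differentiable (by simp)).differentiableAt
        (x := y)).hasFDerivAt
      rw [(hasFDerivAt_pi'.1 h d).fderiv]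
      rfl
    let X : Fin n → Fin n → ℝ := fun c d => Matrix.det (Function.update (Function.update
      (fun l => gradRow (u l) y) i₀ (Pi.single c 1)) j (Pi.single d 1))
    let H : Fin n → Fin n → ℝ := fun c d =>
      fderiv ℝ (fun z => gradRow (u j) z d) y (EuclideanSpace.single c 1)
    -- For a row `j ≠ i₀`, the contribution is the contraction of the symmetric Hessian `H` of `u j`
    -- with `X`, which is antisymmetric because exchanging `c` and `d` swaps two rows. It vanishes.
    have hX : ∀ c d, X c d = - X d c := by
      intro c d
      have := (Matrix.detRowAlternating (n := Fin n) (R := ℝ)).map_swap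
        (Function.update (Function.update (fun l => gradRow (u l) y) i₀ (Pi.single d 1)) j
          (Pi.single c 1)) (i := j) (j := i₀) hj
      refine Eq.trans ?_ this
      simp only [X]
      change Matrix.det _ = Matrix.det _
      congr 1
      funext l
      by_cases hl : l = j
      · rw [hl]; simp [Ne.symm hj]
      · by_cases hl' : l = i₀
        · rw [hl']; simp [Ne.symm hj]
        · simp [hl, hl', Equiv.swap_apply_of_ne_of_ne]
    have hsum : ∀ c, Matrix.det (Function.update (fun l => r c l y) j
        (fderiv ℝ (r c j) y (EuclideanSpace.single c 1))) = ∑ d, H c d * X c d := by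
      intro c
      rw [hrow', det_update_row_eq_sum]
      refine Finset.sum_congr rfl fun d _ => ?_
      rw [hd]
    simp_rw [hsum]
    have hH : ∀ c d, H c d = H d c := fun c d => gradRow_fderiv_symm (hu j) y c d
    have hneg : ∑ c, ∑ d, H c d * X c d = - ∑ c, ∑ d, H c d * X c d := by
      conv_lhs => rw [Finset.sum_comm]
      rw [← Finset.sum_neg_distrib]
      refine Finset.sum_congr rfl fun c _ => ?_
      rw [← Finset.sum_neg_distrib]
      refine Finset.sum_congr rfl fun d _ => ?_
      rw [hX d c, hH d c]; ring
    linarith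

/-- A Jacobian determinant is a null Lagrangian: its integral vanishes if one of the functions has
compact support. -/
theorem integral_jacDet_eq_zero {u : Fin n → EuclideanSpace ℝ (Fin n) → ℝ}
    (hu : ∀ i, ContDiff ℝ ∞ (u i)) (i₀ : Fin n) (hc : HasCompactSupport (u i₀)) :
    ∫ y, jacDet u y = 0 := by
  let B : Fin n → EuclideanSpace ℝ (Fin n) → ℝ := fun c z =>
    Matrix.det (Function.update (fun j => gradRow (u j) z) i₀ (Pi.single c 1))
  have hB : ∀ c, ContDiff ℝ ∞ (B c) := by
    intro c
    have : B c = fun z => Matrix.det fun j =>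
        (Function.update (fun j => gradRow (u j)) i₀ (fun _ => Pi.single c 1) j) z := by
      funext z
      simp only [B]
      congr 1
      funext j
      by_cases hj : j = i₀
      · subst hj; simp
      · simp [hj]
    rw [this]
    refine contDiff_det_rows fun j => ?_
    by_cases hj : j = i₀
    · subst hj; simp only [Function.update_self]; exact contDiff_const
    · simp only [Function.update_of_ne hj]; exact contDiff_gradRow (hu j)
  have hB' : ∀ c, Continuous fun y => fderiv ℝ (B c) y (EuclideanSpace.single c 1) :=
    fun c => (contDiff_gradRow_apply (hB c) c).continuous
  have hu' : ∀ c, Continuous fun y => fderiv ℝ (u i₀) y (EuclideanSpace.single c 1) :=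
    fun c => (contDiff_gradRow_apply (hu i₀) c).continuous
  have hcs : ∀ c, HasCompactSupport fun y => fderiv ℝ (u i₀) y (EuclideanSpace.single c 1) :=
    fun c => hc.fderiv_apply ℝ _
  have hexp : ∀ y, jacDet u y =
      ∑ c, fderiv ℝ (u i₀) y (EuclideanSpace.single c 1) * B c y := by
    intro y
    have := jacDet_update u i₀ (u i₀) y
    rw [Function.update_eq_self] at this
    rw [this, det_update_row_eq_sum]
    rfl
  have hi1 : ∀ c, Integrable fun y => fderiv ℝ (u i₀) y (EuclideanSpace.single c 1) * B c y :=
    fun c => ((hu' c).mul (hB c).continuous).integrable_of_hasCompactSupport (hcs c).mul_right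
  have hi2 : ∀ c, Integrable fun y => u i₀ y * fderiv ℝ (B c) y (EuclideanSpace.single c 1) :=
    fun c => ((hu i₀).continuous.mul (hB' c)).integrable_of_hasCompactSupport hc.mul_right
  have hi3 : ∀ c, Integrable fun y => u i₀ y * B c y :=
    fun c => ((hu i₀).continuous.mul (hB c).continuous).integrable_of_hasCompactSupport
      hc.mul_right
  simp_rw [hexp]
  rw [integral_finsetSum _ fun c _ => hi1 c]
  -- Integrating by parts in each direction puts the derivative on the cofactors, whose divergence
  -- is zero.
  have hparts : ∀ c, ∫ y, fderiv ℝ (u i₀) y (EuclideanSpace.single c 1) * B c y =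
      - ∫ y, u i₀ y * fderiv ℝ (B c) y (EuclideanSpace.single c 1) := by
    intro c
    rw [integral_mul_fderiv_eq_neg_fderiv_mul_of_integrable (hi1 c) (hi2 c) (hi3 c)
      (fun y _ => ((hu i₀).differentiable (by simp)).differentiableAt)
      (fun y _ => ((hB c).differentiable (by simp)).differentiableAt), neg_neg]
  simp_rw [hparts]
  rw [Finset.sum_neg_distrib, ← integral_finsetSum _ fun c _ => hi2 c]
  simp_rw [← Finset.mul_sum]
  have : ∀ y, ∑ c, fderiv ℝ (B c) y (EuclideanSpace.single c 1) = 0 :=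
    fun y => sum_fderiv_cofactor_eq_zero hu i₀ y
  simp [this]

end JacobianDeterminant

/-! ### The pairing and its Lipschitz bound in the sup norm -/

/-- The integral of `f i₀ dχ ∧ ⋀_{i ≠ i₀} df i`, with `dχ` in position `i₀`. -/
noncomputable def jacPairing {n : ℕ} (χ : EuclideanSpace ℝ (Fin n) → ℝ) (i₀ : Fin n)
    (f : Fin n → EuclideanSpace ℝ (Fin n) → ℝ) : ℝ :=
  ∫ y, f i₀ y * jacDet (Function.update f i₀ χ) y

section JacobianPairing

variable {n : ℕ}

lemma abs_det_le_factorial_mul_prod {M : Fin n → Fin n → ℝ} {b : Fin n → ℝ}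
    (hM : ∀ i j, |M i j| ≤ b i) :
    |Matrix.det M| ≤ (n.factorial : ℝ) * ∏ i, b i := by
  have hdet : Matrix.det M = ∑ s : Equiv.Perm (Fin n), Equiv.Perm.sign s • ∏ i, M i (s i) :=
    (Matrix.det_transpose (Matrix.of M)).symm.trans (Matrix.det_apply _)
  rw [hdet]
  refine (Finset.abs_sum_le_sum_abs _ _).trans ?_
  have : ∀ s : Equiv.Perm (Fin n), |Equiv.Perm.sign s • ∏ i, M i (s i)| ≤
      ∏ i, b i := by
    intro s
    rw [Units.smul_def, zsmul_eq_mul, abs_mul, Finset.abs_prod]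
    have h1 : |((Equiv.Perm.sign s : ℤ) : ℝ)| = 1 := by
      rcases Int.units_eq_one_or (Equiv.Perm.sign s) with h | h <;> simp [h]
    rw [h1, one_mul]
    exact Finset.prod_le_prod (fun _ _ => abs_nonneg _) fun i _ => hM i _
  refine (Finset.sum_le_sum fun s _ => this s).trans ?_
  simp [Finset.card_univ, Fintype.card_perm]

lemma abs_gradRow_le (f : EuclideanSpace ℝ (Fin n) → ℝ) (y : EuclideanSpace ℝ (Fin n))
    (c : Fin n) : |gradRow f y c| ≤ ‖fderiv ℝ f y‖ := by
  have := (fderiv ℝ f y).le_opNorm (EuclideanSpace.single c 1)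
  simpa [gradRow] using this

lemma gradRow_mul {f g : EuclideanSpace ℝ (Fin n) → ℝ} (hf : ContDiff ℝ ∞ f)
    (hg : ContDiff ℝ ∞ g) (y : EuclideanSpace ℝ (Fin n)) :
    gradRow (fun z => f z * g z) y = f y • gradRow g y + g y • gradRow f y := by
  ext c
  unfold gradRow
  rw [fderiv_fun_mul ((hf.differentiable (by simp)).differentiableAt)
    ((hg.differentiable (by simp)).differentiableAt)]
  simp

lemma contDiff_update_apply {f : Fin n → EuclideanSpace ℝ (Fin n) → ℝ}
    (hf : ∀ i, ContDiff ℝ ∞ (f i)) (i : Fin n) {h : EuclideanSpace ℝ (Fin n) → ℝ}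
    (hh : ContDiff ℝ ∞ h) (j : Fin n) : ContDiff ℝ ∞ (Function.update f i h j) := by
  by_cases hj : j = i
  · rw [hj]; simpa using hh
  · simpa [hj] using hf j

lemma hasCompactSupport_jacDet {u : Fin n → EuclideanSpace ℝ (Fin n) → ℝ} {i₀ : Fin n}
    (hc : HasCompactSupport (u i₀)) : HasCompactSupport (jacDet u) := by
  refine (hc.fderiv ℝ).mono fun y hy => ?_
  contrapose! hy
  simp only [Function.mem_support, not_not] at hy ⊢
  refine Matrix.det_eq_zero_of_row_eq_zero i₀ fun c => ?_
  simp [gradRow, hy]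

lemma integrable_mul_jacDet {u : Fin n → EuclideanSpace ℝ (Fin n) → ℝ} {i₀ : Fin n}
    (hu : ∀ i, ContDiff ℝ ∞ (u i)) (hc : HasCompactSupport (u i₀))
    {f : EuclideanSpace ℝ (Fin n) → ℝ} (hf : Continuous f) :
    Integrable fun y => f y * jacDet u y :=
  (hf.mul (contDiff_jacDet hu).continuous).integrable_of_hasCompactSupport
    (hasCompactSupport_jacDet hc).mul_left

/-- Integration by parts exchanges the undifferentiated factor with any differentiated one. -/
lemma jacPairing_swap {χ : EuclideanSpace ℝ (Fin n) → ℝ} (hχ : ContDiff ℝ ∞ χ)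
    (hc : HasCompactSupport χ) {f : Fin n → EuclideanSpace ℝ (Fin n) → ℝ}
    (hf : ∀ i, ContDiff ℝ ∞ (f i)) {i₀ i : Fin n} (hi : i ≠ i₀) :
    jacPairing χ i₀ f =
      -∫ y, f i y * jacDet (Function.update (Function.update f i (f i₀)) i₀ χ) y := by
  -- With `f i₀ * f i` in row `i` and the compactly supported `χ` in row `i₀`, the Jacobian
  -- integrates to zero. The product rule splits it into the two integrals to be compared.
  let u := Function.update (Function.update f i₀ χ) i (fun y => f i₀ y * f i y)
  have hu : ∀ j, ContDiff ℝ ∞ (u j) :=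
    contDiff_update_apply (contDiff_update_apply hf i₀ hχ) i ((hf i₀).mul (hf i))
  have hui : u i₀ = χ := by simp [u, hi.symm]
  have h0 := integral_jacDet_eq_zero hu i₀ (by rwa [hui])
  have hsplit : ∀ y, jacDet u y = f i₀ y * jacDet (Function.update f i₀ χ) y +
      f i y * jacDet (Function.update (Function.update f i (f i₀)) i₀ χ) y := by
    intro y
    rw [Function.update_comm hi, jacDet_update _ i (f i₀), jacDet_update _ i,
      gradRow_mul (hf i₀) (hf i)]
    have e1 := (detRowCMM n).toMultilinearMap.map_update_add
      (fun j => gradRow (Function.update f i₀ χ j) y) i (f i₀ y • gradRow (f i) y)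
      (f i y • gradRow (f i₀) y)
    rw [MultilinearMap.map_update_smul, MultilinearMap.map_update_smul] at e1
    refine e1.trans ?_
    simp only [smul_eq_mul]
    congr 2
    have : Function.update (fun j => gradRow (Function.update f i₀ χ j) y) i (gradRow (f i) y) =
        fun j => gradRow (Function.update f i₀ χ j) y := by
      conv_rhs => rw [← Function.update_eq_self i (fun j => gradRow (Function.update f i₀ χ j) y)]
      rw [Function.update_of_ne hi]
    rw [this]
    rfl
  simp_rw [hsplit] at h0
  have hc1 : HasCompactSupport (Function.update f i₀ χ i₀) := by simpa using hc
  have hc2 : HasCompactSupport (Function.update (Function.update f i (f i₀)) i₀ χ i₀) := by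
    simpa using hc
  rw [integral_add (integrable_mul_jacDet (contDiff_update_apply hf i₀ hχ) hc1 (hf i₀).continuous)
    (integrable_mul_jacDet (contDiff_update_apply (contDiff_update_apply hf i (hf i₀)) i₀ hχ) hc2
      (hf i).continuous)] at h0
  unfold jacPairing
  linarith

lemma abs_jacDet_le {u : Fin n → EuclideanSpace ℝ (Fin n) → ℝ} {i₀ : Fin n} {A : ℝ}
    (y : EuclideanSpace ℝ (Fin n)) (hA : ∀ i, i ≠ i₀ → ‖fderiv ℝ (u i) y‖ ≤ A) :
    |jacDet u y| ≤ n.factorial * (‖fderiv ℝ (u i₀) y‖ * A ^ (n - 1)) := by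
  have h := abs_det_le_factorial_mul_prod (M := fun i => gradRow (u i) y)
    (b := Function.update (fun _ => A) i₀ ‖fderiv ℝ (u i₀) y‖) (fun i j => by
      by_cases hi : i = i₀
      · rw [hi, Function.update_self]; exact abs_gradRow_le _ _ _
      · rw [Function.update_of_ne hi]; exact (abs_gradRow_le _ _ _).trans (hA i hi))
  rw [Finset.prod_update_of_mem (Finset.mem_univ _)] at h
  simpa [Finset.prod_const, Finset.card_sdiff, jacDet] using h

/-- Changing one of the functions in `jacPairing`. -/
lemma abs_jacPairing_sub_update_le {χ : EuclideanSpace ℝ (Fin n) → ℝ} (hχ : ContDiff ℝ ∞ χ)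
    (hc : HasCompactSupport χ) (i₀ i : Fin n) {f : Fin n → EuclideanSpace ℝ (Fin n) → ℝ}
    (hf : ∀ j, ContDiff ℝ ∞ (f j)) {h : EuclideanSpace ℝ (Fin n) → ℝ} (hh : ContDiff ℝ ∞ h)
    {A δ : ℝ} (hfA : ∀ j y, ‖fderiv ℝ (f j) y‖ ≤ A) (hδ : ∀ y, |f i y - h y| ≤ δ) :
    |jacPairing χ i₀ f - jacPairing χ i₀ (Function.update f i h)| ≤
      (n.factorial * ∫ y, ‖fderiv ℝ χ y‖) * (δ * A ^ (n - 1)) := by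
  have hint : Integrable fun y => ‖fderiv ℝ χ y‖ :=
    ((hχ.continuous_fderiv (by simp)).integrable_of_hasCompactSupport (hc.fderiv ℝ)).norm
  have hA0 : 0 ≤ A := (norm_nonneg _).trans (hfA i₀ 0)
  have hδ0 : 0 ≤ δ := (abs_nonneg _).trans (hδ 0)
  -- It is enough to change the undifferentiated factor: a swap brings any other `f i` into that
  -- place. The changed function is then never differentiated, so no gradient bound on `h` is
  -- needed.
  have key : ∀ u : Fin n → EuclideanSpace ℝ (Fin n) → ℝ, (∀ j, ContDiff ℝ ∞ (u j)) → u i₀ = χ →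
      (∀ j, j ≠ i₀ → ∀ y, ‖fderiv ℝ (u j) y‖ ≤ A) →
      |(∫ y, f i y * jacDet u y) - ∫ y, h y * jacDet u y| ≤
      (n.factorial * ∫ y, ‖fderiv ℝ χ y‖) * (δ * A ^ (n - 1)) := by
    intro u hu hui huA
    have hcu : HasCompactSupport (u i₀) := by rwa [hui]
    rw [← integral_sub (integrable_mul_jacDet hu hcu (hf i).continuous)
      (integrable_mul_jacDet hu hcu hh.continuous), ← Real.norm_eq_abs]
    refine (norm_integral_le_of_norm_le
      (hint.const_mul (n.factorial * (δ * A ^ (n - 1)))) (ae_of_all _ fun y => ?_)).trans ?_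
    · rw [← sub_mul, norm_mul, Real.norm_eq_abs, Real.norm_eq_abs]
      have h1 := abs_jacDet_le (u := u) (i₀ := i₀) y fun j hj => huA j hj y
      rw [hui] at h1
      calc _ ≤ δ * (n.factorial * (‖fderiv ℝ χ y‖ * A ^ (n - 1))) :=
            mul_le_mul (hδ y) h1 (abs_nonneg _) hδ0
        _ = _ := by ring
    · rw [integral_const_mul]; exact le_of_eq (by ring)
  by_cases hi : i = i₀
  · subst hi
    have := key (Function.update f i χ) (contDiff_update_apply hf i hχ) (by simp)
      (fun j hj y => by simpa [hj] using hfA j y)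
    simpa [jacPairing] using this
  · rw [jacPairing_swap hχ hc hf hi, jacPairing_swap hχ hc (contDiff_update_apply hf i hh) hi]
    have := key (Function.update (Function.update f i (f i₀)) i₀ χ)
      (contDiff_update_apply (contDiff_update_apply hf i (hf i₀)) i₀ hχ) (by simp) (fun j hj y => by
        rw [Function.update_of_ne hj]
        by_cases hji : j = i
        · rw [hji, Function.update_self]; exact hfA _ _
        · rw [Function.update_of_ne hji]; exact hfA _ _)
    simp only [Function.update_self, Function.update_of_ne (Ne.symm hi), Function.update_idem]
    rwa [neg_sub_neg, abs_sub_comm]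

/-- `jacPairing` depends on its arguments in a Lipschitz way with respect to the uniform distance,
with a constant controlled by the gradients. -/
theorem abs_jacPairing_sub_le {χ : EuclideanSpace ℝ (Fin n) → ℝ} (hχ : ContDiff ℝ ∞ χ)
    (hc : HasCompactSupport χ) (i₀ : Fin n) {f g : Fin n → EuclideanSpace ℝ (Fin n) → ℝ}
    (hf : ∀ j, ContDiff ℝ ∞ (f j)) (hg : ∀ j, ContDiff ℝ ∞ (g j))
    {A δ : ℝ} (hfA : ∀ j y, ‖fderiv ℝ (f j) y‖ ≤ A) (hgA : ∀ j y, ‖fderiv ℝ (g j) y‖ ≤ A)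
    (hδ : ∀ j y, |f j y - g j y| ≤ δ) :
    |jacPairing χ i₀ f - jacPairing χ i₀ g| ≤
      n * (n.factorial * ∫ y, ‖fderiv ℝ χ y‖) * (δ * A ^ (n - 1)) := by
  classical
  -- The functions are exchanged one at a time; those with index in `s` have already become `g`.
  have H : ∀ s : Finset (Fin n), |jacPairing χ i₀ f - jacPairing χ i₀ (s.piecewise g f)| ≤
      s.card * (n.factorial * ∫ y, ‖fderiv ℝ χ y‖) * (δ * A ^ (n - 1)) := by
    intro s
    induction s using Finset.induction_on with
    | empty => simp
    | insert i s hi ih =>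
      have hp : ∀ j, ContDiff ℝ ∞ (s.piecewise g f j) := fun j => by
        by_cases hj : j ∈ s
        · simpa [hj] using hg j
        · simpa [hj] using hf j
      have hpA : ∀ j y, ‖fderiv ℝ (s.piecewise g f j) y‖ ≤ A := fun j y => by
        by_cases hj : j ∈ s
        · simpa [hj] using hgA j y
        · simpa [hj] using hfA j y
      have h1 := abs_jacPairing_sub_update_le hχ hc i₀ i hp (hg i) hpA
        (fun y => by simpa [hi] using hδ i y)
      rw [Finset.piecewise_insert, Finset.card_insert_of_notMem hi]
      refine (abs_sub_le _ _ _).trans ((add_le_add ih h1).trans (le_of_eq ?_))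
      push_cast; ring
  simpa [Finset.piecewise_univ] using H Finset.univ

end JacobianPairing

/-! ### Mollification of Hölder functions -/

section Mollification

open scoped Convolution

variable {n : ℕ} {V : Type*} [NormedAddCommGroup V] [NormedSpace ℝ V]

/-- A smooth bump function supported in the closed unit ball. -/
noncomputable def unitBump (n : ℕ) : ContDiffBump (0 : EuclideanSpace ℝ (Fin n)) :=
  ⟨1 / 2, 1, by norm_num, by norm_num⟩

/-- Convolution with a fixed smooth probability density supported in the unit ball. -/
noncomputable def unitMollify (f : EuclideanSpace ℝ (Fin n) → V) : EuclideanSpace ℝ (Fin n) → V :=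
  (unitBump n).normed volume ⋆[ContinuousLinearMap.lsmul ℝ ℝ, volume] f

/-- Mollification at scale `ε`. -/
noncomputable def mollify (ε : ℝ) (f : EuclideanSpace ℝ (Fin n) → V)
    (y : EuclideanSpace ℝ (Fin n)) : V :=
  unitMollify (fun z => f (ε • z)) (ε⁻¹ • y)

lemma integrable_bump_smul {f : EuclideanSpace ℝ (Fin n) → V} (hf : Continuous f)
    (x : EuclideanSpace ℝ (Fin n)) :
    Integrable fun t => (unitBump n).normed volume t • f (x - t) :=
  ((unitBump n).continuous_normed.smul (by fun_prop)).integrable_of_hasCompactSupport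
    (unitBump n).hasCompactSupport_normed.smul_right

lemma unitMollify_apply (f : EuclideanSpace ℝ (Fin n) → V) (x : EuclideanSpace ℝ (Fin n)) :
    unitMollify f x = ∫ t, (unitBump n).normed volume t • f (x - t) := rfl

/-- Averages of nearby functions at nearby points are close. -/
lemma norm_unitMollify_sub_le {f g : EuclideanSpace ℝ (Fin n) → V} (hf : Continuous f)
    (hg : Continuous g) {x y : EuclideanSpace ℝ (Fin n)} {δ : ℝ}
    (h : ∀ t, ‖f (x - t) - g (y - t)‖ ≤ δ) : ‖unitMollify f x - unitMollify g y‖ ≤ δ := by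
  rw [unitMollify_apply, unitMollify_apply,
    ← integral_sub (integrable_bump_smul hf x) (integrable_bump_smul hg y)]
  refine (norm_integral_le_of_norm_le ((unitBump n).integrable_normed.mul_const δ)
    (ae_of_all _ fun t => ?_)).trans ?_
  · rw [← smul_sub, norm_smul, Real.norm_of_nonneg ((unitBump n).nonneg_normed t)]
    exact mul_le_mul_of_nonneg_left (h t) ((unitBump n).nonneg_normed t)
  · rw [integral_mul_const, (unitBump n).integral_normed, one_mul]

lemma norm_unitMollify_sub_self_le [FiniteDimensional ℝ V] {f : EuclideanSpace ℝ (Fin n) → V}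
    (hf : Continuous f) {δ : ℝ} (h : ∀ x y, ‖x - y‖ ≤ 1 → ‖f x - f y‖ ≤ δ) (x : EuclideanSpace ℝ (Fin n)) :
    ‖unitMollify f x - f x‖ ≤ δ := by
  rw [← dist_eq_norm]
  refine ContDiffBump.dist_normed_convolution_le hf.aestronglyMeasurable fun z hz => ?_
  rw [dist_eq_norm]
  exact h _ _ (by rw [← dist_eq_norm]; exact (Metric.mem_ball.1 hz).le)

lemma contDiff_unitMollify {f : EuclideanSpace ℝ (Fin n) → V} (hf : Continuous f) :
    ContDiff ℝ ∞ (unitMollify f) :=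
  (unitBump n).hasCompactSupport_normed.contDiff_convolution_left _ (unitBump n).contDiff_normed
    hf.locallyIntegrable

lemma norm_fderiv_unitMollify_le [FiniteDimensional ℝ V] {f : EuclideanSpace ℝ (Fin n) → V}
    (hf : Continuous f) {δ : ℝ} (h : ∀ x y, ‖x - y‖ ≤ 1 → ‖f x - f y‖ ≤ δ) (x : EuclideanSpace ℝ (Fin n)) :
    ‖fderiv ℝ (unitMollify f) x‖ ≤
      (∫ t, ‖fderiv ℝ ((unitBump n).normed (volume : Measure (EuclideanSpace ℝ (Fin n)))) t‖) *
        δ := by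
  set ρ := (unitBump n).normed (volume : Measure (EuclideanSpace ℝ (Fin n))) with hρ
  have hδ : 0 ≤ δ := (norm_nonneg _).trans (h 0 0 (by simp))
  have hρc : HasCompactSupport ρ := (unitBump n).hasCompactSupport_normed
  have hρs : ContDiff ℝ 1 ρ := (unitBump n).contDiff_normed
  have hg : Continuous fun z => f z - f x := hf.sub continuous_const
  -- The kernel has integral one, so subtracting the constant `f x` does not affect the derivative
  -- at `x`; the bound then involves only the oscillation of `f` on the unit ball around `x`.
  have heq : unitMollify f = fun y => unitMollify (fun z => f z - f x) y + f x := by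
    funext y
    rw [unitMollify_apply, unitMollify_apply]
    simp_rw [smul_sub]
    rw [integral_sub (integrable_bump_smul hf y) ((unitBump n).integrable_normed.smul_const _),
      (unitBump n).integral_normed_smul, sub_add_cancel]
  have hd := hρc.hasFDerivAt_convolution_left (ContinuousLinearMap.lsmul ℝ ℝ) hρs
    (hg.locallyIntegrable (μ := volume)) x
  have hd' : HasFDerivAt (fun y => unitMollify (fun z => f z - f x) y + f x) _ x :=
    hd.add_const (f x)
  rw [heq, hd'.fderiv, convolution_def]
  have hfi : Integrable fun t => ‖fderiv ℝ ρ t‖ :=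
    ((hρs.continuous_fderiv one_ne_zero).integrable_of_hasCompactSupport (hρc.fderiv ℝ)).norm
  refine (norm_integral_le_of_norm_le (hfi.mul_const δ) (ae_of_all _ fun t => ?_)).trans ?_
  · by_cases ht : t ∈ tsupport ρ
    · have ht1 : ‖t‖ ≤ 1 := by
        have := (unitBump n).tsupport_normed_eq (μ := volume)
        rw [← hρ] at this
        rw [this] at ht
        simpa [unitBump] using ht
      refine ContinuousLinearMap.opNorm_le_bound _ (by positivity) fun v => ?_
      have h1 : ‖fderiv ℝ ρ t v‖ ≤ ‖fderiv ℝ ρ t‖ * ‖v‖ := (fderiv ℝ ρ t).le_opNorm v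
      have h2 : ‖f (x - t) - f x‖ ≤ δ := h _ _ (by simpa using ht1)
      calc _ = ‖fderiv ℝ ρ t v‖ * ‖f (x - t) - f x‖ := by
            rw [← norm_smul, smul_sub]; simp [ContinuousLinearMap.precompL_apply]
        _ ≤ (‖fderiv ℝ ρ t‖ * ‖v‖) * δ := mul_le_mul h1 h2 (norm_nonneg _) (by positivity)
        _ = _ := by ring
    · have : fderiv ℝ ρ t = 0 := by
        have := fun h => ht (support_fderiv_subset ℝ h)
        simpa using this
      simp [this]
  · rw [integral_mul_const]

/-- The constant in the gradient bound for mollifications. -/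
noncomputable def mollifyConst (n : ℕ) : ℝ :=
  ∫ t, ‖fderiv ℝ ((unitBump n).normed (volume : Measure (EuclideanSpace ℝ (Fin n)))) t‖

lemma mollifyConst_nonneg (n : ℕ) : 0 ≤ mollifyConst n :=
  integral_nonneg fun _ => norm_nonneg _

omit [NormedSpace ℝ V] in
lemma continuous_comp_smul {f : EuclideanSpace ℝ (Fin n) → V} (hf : Continuous f) (ε : ℝ) :
    Continuous fun z => f (ε • z) := by fun_prop

lemma contDiff_mollify {f : EuclideanSpace ℝ (Fin n) → V} (hf : Continuous f) (ε : ℝ) :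
    ContDiff ℝ ∞ (mollify ε f) :=
  (contDiff_unitMollify (continuous_comp_smul hf ε)).comp (contDiff_const_smul ε⁻¹)

lemma norm_mollify_sub_mollify_le {f g : EuclideanSpace ℝ (Fin n) → V} (hf : Continuous f)
    (hg : Continuous g) {δ : ℝ} (h : ∀ y, ‖f y - g y‖ ≤ δ) (ε : ℝ)
    (y : EuclideanSpace ℝ (Fin n)) : ‖mollify ε f y - mollify ε g y‖ ≤ δ :=
  norm_unitMollify_sub_le (continuous_comp_smul hf ε) (continuous_comp_smul hg ε) fun _ => h _

omit [NormedSpace ℝ V] in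
lemma HolderWith.norm_comp_smul_sub_le {C σ : ℝ≥0} {f : EuclideanSpace ℝ (Fin n) → V}
    (hf : HolderWith C σ f) {ε : ℝ} (hε : 0 < ε) (x y : EuclideanSpace ℝ (Fin n))
    (hxy : ‖x - y‖ ≤ 1) : ‖f (ε • x) - f (ε • y)‖ ≤ C * ε ^ (σ : ℝ) := by
  have h := hf.dist_le (ε • x) (ε • y)
  rw [dist_eq_norm, dist_eq_norm, ← smul_sub, norm_smul, Real.norm_of_nonneg hε.le] at h
  refine h.trans (mul_le_mul_of_nonneg_left ?_ C.2)
  refine Real.rpow_le_rpow (by positivity) ?_ σ.2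
  exact mul_le_of_le_one_right hε.le hxy

lemma HolderWith.norm_mollify_sub_self_le [FiniteDimensional ℝ V] {C σ : ℝ≥0} (hσ : 0 < σ)
    {f : EuclideanSpace ℝ (Fin n) → V} (hf : HolderWith C σ f) {ε : ℝ} (hε : 0 < ε)
    (y : EuclideanSpace ℝ (Fin n)) : ‖mollify ε f y - f y‖ ≤ C * ε ^ (σ : ℝ) := by
  have h := norm_unitMollify_sub_self_le (continuous_comp_smul (hf.continuous hσ) ε)
    (hf.norm_comp_smul_sub_le hε) (ε⁻¹ • y)
  rwa [smul_inv_smul₀ hε.ne'] at h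

/-- The rescaled function `f (ε • ·)` oscillates by at most `C ε^σ` on unit balls, and undoing the
scaling costs a factor `ε⁻¹`. -/
lemma HolderWith.norm_fderiv_mollify_le [FiniteDimensional ℝ V] {C σ : ℝ≥0} (hσ : 0 < σ)
    {f : EuclideanSpace ℝ (Fin n) → V} (hf : HolderWith C σ f) {ε : ℝ} (hε : 0 < ε)
    (y : EuclideanSpace ℝ (Fin n)) :
    ‖fderiv ℝ (mollify ε f) y‖ ≤ mollifyConst n * C * ε ^ ((σ : ℝ) - 1) := by
  have h := norm_fderiv_unitMollify_le (continuous_comp_smul (hf.continuous hσ) ε)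
    (hf.norm_comp_smul_sub_le hε) (ε⁻¹ • y)
  have he : fderiv ℝ (mollify ε f) y =
      ε⁻¹ • fderiv ℝ (unitMollify fun z => f (ε • z)) (ε⁻¹ • y) :=
    fderiv_comp_smul (f := unitMollify fun z => f (ε • z)) (x := y) ε⁻¹
  rw [he, norm_smul, Real.norm_of_nonneg (inv_pos.2 hε).le, Real.rpow_sub hε, Real.rpow_one]
  refine (mul_le_mul_of_nonneg_left h (inv_pos.2 hε).le).trans (le_of_eq ?_)
  unfold mollifyConst
  ring

lemma HolderWith.of_dist_le {X Y : Type*} [PseudoMetricSpace X] [PseudoMetricSpace Y]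
    {C σ : ℝ≥0} {f : X → Y} (h : ∀ x y, dist (f x) (f y) ≤ C * dist x y ^ (σ : ℝ)) :
    HolderWith C σ f := by
  intro x y
  rw [edist_nndist, edist_nndist, ← ENNReal.coe_rpow_of_nonneg _ (NNReal.coe_nonneg σ), ← ENNReal.coe_mul,
    ENNReal.coe_le_coe, ← NNReal.coe_le_coe]
  simpa using h x y

lemma HolderWith.mollify {C σ : ℝ≥0} (hσ : 0 < σ) {f : EuclideanSpace ℝ (Fin n) → V}
    (hf : HolderWith C σ f) {ε : ℝ} (hε : 0 < ε) : HolderWith C σ (mollify ε f) := by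
  refine HolderWith.of_dist_le fun x y => ?_
  rw [dist_eq_norm]
  refine norm_unitMollify_sub_le (continuous_comp_smul (hf.continuous hσ) ε)
    (continuous_comp_smul (hf.continuous hσ) ε) fun t => ?_
  rw [← dist_eq_norm]
  refine (hf.dist_le _ _).trans (le_of_eq ?_)
  congr 2
  rw [dist_eq_norm, dist_eq_norm, ← smul_sub, sub_sub_sub_cancel_right, ← smul_sub,
    smul_inv_smul₀ hε.ne']

end Mollification

/-! ### Uniform continuity of the pairing on Hölder-bounded sets -/

section HolderContinuityOfPairing

variable {n : ℕ}

/-- This identifies the limit of the dyadic telescoping sum. It is the case of exponent one: the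
gradients stay bounded while the sup distance is at most `K 2⁻ᵐ`. The Lipschitz constant `K` enters
no later estimate, since only the limit is used. -/
lemma tendsto_jacPairing_mollify {χ : EuclideanSpace ℝ (Fin n) → ℝ} (hχ : ContDiff ℝ ∞ χ)
    (hc : HasCompactSupport χ) (i₀ : Fin n) {f : Fin n → EuclideanSpace ℝ (Fin n) → ℝ}
    (hf : ∀ i, ContDiff ℝ ∞ (f i)) {K : ℝ≥0} (hK : ∀ i, LipschitzWith K (f i)) :
    Tendsto (fun m : ℕ => jacPairing χ i₀ fun i => mollify ((1 / 2) ^ m) (f i)) atTop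
      (𝓝 (jacPairing χ i₀ f)) := by
  have hK1 : ∀ i, HolderWith K 1 (f i) := fun i => holderWith_one.2 (hK i)
  rw [tendsto_iff_dist_tendsto_zero]
  set A : ℝ := max (mollifyConst n * K) K with hA
  set c : ℝ := n * (n.factorial * ∫ y, ‖fderiv ℝ χ y‖)
  have hlim : Tendsto (fun m : ℕ => c * ((K * (1 / 2) ^ m) * A ^ (n - 1))) atTop (𝓝 0) := by
    have h1 : Tendsto (fun m : ℕ => (1 / 2 : ℝ) ^ m) atTop (𝓝 0) :=
      tendsto_pow_atTop_nhds_zero_of_lt_one (by norm_num) (by norm_num)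
    simpa using ((h1.const_mul (K : ℝ)).mul_const (A ^ (n - 1))).const_mul c
  refine squeeze_zero (fun _ => dist_nonneg) (fun m => ?_) hlim
  have hm : (0 : ℝ) < (1 / 2) ^ m := by positivity
  refine abs_jacPairing_sub_le hχ hc i₀ (fun i => contDiff_mollify (hf i).continuous _) hf
    (fun i y => ?_) (fun i y => ?_) (fun i y => ?_)
  · have h := (hK1 i).norm_fderiv_mollify_le one_pos hm y
    refine le_trans ?_ (le_max_left _ _)
    simpa using h
  · exact (norm_fderiv_le_of_lipschitz ℝ (hK i)).trans (le_max_right _ _)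
  · have h := (hK1 i).norm_mollify_sub_self_le one_pos hm y
    simpa using h

/-- The error made in `jacPairing` by mollifying at scale `2⁻ᵐ` is bounded uniformly in terms of the
Hölder constant. -/
lemma exists_abs_jacPairing_mollify_sub_le {χ : EuclideanSpace ℝ (Fin n) → ℝ}
    (hχ : ContDiff ℝ ∞ χ) (hc : HasCompactSupport χ) (i₀ : Fin n) {σ : ℝ≥0} (hσ : 0 < σ)
    (hσ1 : σ ≤ 1) (hγ : 0 < (σ : ℝ) + (n - 1 : ℕ) * ((σ : ℝ) - 1)) (C : ℝ≥0) :
    ∃ B q : ℝ, 0 ≤ q ∧ q < 1 ∧ ∀ f : Fin n → EuclideanSpace ℝ (Fin n) → ℝ,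
      (∀ i, ContDiff ℝ ∞ (f i)) → (∃ K, ∀ i, LipschitzWith K (f i)) →
      (∀ i, HolderWith C σ (f i)) → ∀ m : ℕ,
      |jacPairing χ i₀ (fun i => mollify ((1 / 2) ^ m) (f i)) - jacPairing χ i₀ f| ≤
        B * q ^ m := by
  set γ : ℝ := (σ : ℝ) + (n - 1 : ℕ) * ((σ : ℝ) - 1) with hγd
  set c : ℝ := n * (n.factorial * ∫ y, ‖fderiv ℝ χ y‖)
  set q : ℝ := (1 / 2 : ℝ) ^ γ with hq
  -- The factor `(1 / 2) ^ (σ - 1) ≥ 1` lets one gradient bound `D ε^(σ - 1)` serve for both scales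
  -- `ε` and `ε / 2`.
  set D : ℝ := mollifyConst n * C * (1 / 2) ^ ((σ : ℝ) - 1) with hD
  have hM := mollifyConst_nonneg n
  have hq0 : 0 ≤ q := by positivity
  have hq1 : q < 1 := Real.rpow_lt_one (by norm_num) (by norm_num) hγ
  refine ⟨c * (2 * C * D ^ (n - 1)) / (1 - q), q, hq0, hq1, ?_⟩
  rintro f hf ⟨K, hK⟩ hH m
  -- For consecutive scales the sup distance is at most `2 C ε^σ`. Together with `n - 1` gradient
  -- factors this gives the power `ε^γ = q ^ m`.
  have hstep : ∀ m : ℕ, dist (jacPairing χ i₀ fun i => mollify ((1 / 2) ^ m) (f i))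
      (jacPairing χ i₀ fun i => mollify ((1 / 2) ^ (m + 1)) (f i)) ≤
      (c * (2 * C * D ^ (n - 1))) * q ^ m := by
    intro m
    set ε : ℝ := (1 / 2) ^ m with hε
    have hε0 : 0 < ε := by positivity
    have hε2 : (1 / 2 : ℝ) ^ (m + 1) = ε * (1 / 2) := pow_succ _ _
    rw [hε2]
    have h1 : (1 : ℝ) ≤ (1 / 2) ^ ((σ : ℝ) - 1) :=
      Real.one_le_rpow_of_pos_of_le_one_of_nonpos (by norm_num) (by norm_num)
        (sub_nonpos.2 (by exact_mod_cast hσ1))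
    have hbase := abs_jacPairing_sub_le hχ hc i₀
      (f := fun i => mollify ε (f i)) (g := fun i => mollify (ε * (1 / 2)) (f i))
      (fun i => contDiff_mollify (hf i).continuous _)
      (fun i => contDiff_mollify (hf i).continuous _) (A := D * ε ^ ((σ : ℝ) - 1))
      (δ := 2 * C * ε ^ (σ : ℝ)) (fun i y => ?_) (fun i y => ?_) (fun i y => ?_)
    · refine hbase.trans (le_of_eq ?_)
      have : ε ^ (σ : ℝ) * (ε ^ ((σ : ℝ) - 1)) ^ (n - 1) = q ^ m := by
        rw [← Real.rpow_natCast (ε ^ ((σ : ℝ) - 1)), ← Real.rpow_mul hε0.le,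
          ← Real.rpow_add hε0, mul_comm ((σ : ℝ) - 1), ← hγd, hε, hq, ← Real.rpow_natCast,
          ← Real.rpow_natCast, ← Real.rpow_mul (by norm_num), ← Real.rpow_mul (by norm_num),
          mul_comm]
      rw [mul_pow, ← this]
      ring
    · refine ((hH i).norm_fderiv_mollify_le hσ hε0 y).trans ?_
      have h2 : 0 ≤ mollifyConst n * C * ε ^ ((σ : ℝ) - 1) := by positivity
      calc _ ≤ mollifyConst n * C * ε ^ ((σ : ℝ) - 1) * (1 / 2) ^ ((σ : ℝ) - 1) :=
            le_mul_of_one_le_right h2 h1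
        _ = _ := by rw [hD]; ring
    · refine ((hH i).norm_fderiv_mollify_le hσ (by positivity) y).trans (le_of_eq ?_)
      rw [Real.mul_rpow hε0.le (by norm_num), hD]; ring
    · have h2 := (hH i).norm_mollify_sub_self_le hσ hε0 y
      have h3 := (hH i).norm_mollify_sub_self_le hσ (ε := ε * (1 / 2)) (by positivity) y
      have h4 : (ε * (1 / 2)) ^ (σ : ℝ) ≤ ε ^ (σ : ℝ) :=
        Real.rpow_le_rpow (by positivity) (by linarith) σ.2
      have h5 : (C : ℝ) * (ε * (1 / 2)) ^ (σ : ℝ) ≤ C * ε ^ (σ : ℝ) :=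
        mul_le_mul_of_nonneg_left h4 C.2
      rw [Real.norm_eq_abs] at h2 h3
      rw [abs_le] at h2 h3 ⊢
      constructor <;> linarith [h2.1, h2.2, h3.1, h3.2]
  have h := dist_le_of_le_geometric_of_tendsto q _ hq1 hstep
    (tendsto_jacPairing_mollify hχ hc i₀ hf hK) m
  rw [Real.dist_eq] at h
  exact h.trans (le_of_eq (by ring))

/-- On bounded sets of Hölder functions with exponent `σ > (n - 1) / n`, the pairing is uniformly
continuous with respect to uniform convergence. -/
theorem jacPairing_uniformContinuous_holder {χ : EuclideanSpace ℝ (Fin n) → ℝ}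
    (hχ : ContDiff ℝ ∞ χ) (hc : HasCompactSupport χ) (i₀ : Fin n) {σ : ℝ≥0} (hσ : 0 < σ)
    (hσ1 : σ ≤ 1) (hγ : 0 < (σ : ℝ) + (n - 1 : ℕ) * ((σ : ℝ) - 1)) (C : ℝ≥0) {η : ℝ}
    (hη : 0 < η) :
    ∃ δ > 0, ∀ f g : Fin n → EuclideanSpace ℝ (Fin n) → ℝ,
      (∀ i, ContDiff ℝ ∞ (f i)) → (∃ K, ∀ i, LipschitzWith K (f i)) →
      (∀ i, HolderWith C σ (f i)) →
      (∀ i, ContDiff ℝ ∞ (g i)) → (∃ K, ∀ i, LipschitzWith K (g i)) →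
      (∀ i, HolderWith C σ (g i)) →
      (∀ i y, |f i y - g i y| ≤ δ) → |jacPairing χ i₀ f - jacPairing χ i₀ g| ≤ η := by
  obtain ⟨B, q, hq0, hq1, hB⟩ := exists_abs_jacPairing_mollify_sub_le hχ hc i₀ hσ hσ1 hγ C
  -- The scale is fixed so that each mollification error is below `η / 3`. It depends on `C`, `σ`,
  -- `χ` and `η`, but not on `f` or `g`.
  obtain ⟨m, hm⟩ : ∃ m : ℕ, B * q ^ m < η / 3 := by
    have h : Tendsto (fun m : ℕ => B * q ^ m) atTop (𝓝 (B * 0)) :=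
      (tendsto_pow_atTop_nhds_zero_of_lt_one hq0 hq1).const_mul B
    rw [mul_zero] at h
    exact (h.eventually_lt_const (by positivity)).exists
  set ε : ℝ := (1 / 2) ^ m with hε
  have hε0 : 0 < ε := by positivity
  set A : ℝ := mollifyConst n * C * ε ^ ((σ : ℝ) - 1)
  set c : ℝ := n * (n.factorial * ∫ y, ‖fderiv ℝ χ y‖) with hcd
  have hc0 : 0 ≤ c := mul_nonneg (by positivity)
    (mul_nonneg (by positivity) (integral_nonneg fun _ => norm_nonneg _))
  have hA0 : 0 ≤ A := mul_nonneg (mul_nonneg (mollifyConst_nonneg n) C.2) (by positivity)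
  -- This makes the difference of the mollified pairings at most `η / 3`; the `+ 1` keeps the
  -- denominator positive.
  refine ⟨η / 3 / (c * A ^ (n - 1) + 1), by positivity, ?_⟩
  intro f g hf hfK hfH hg hgK hgH hfg
  have h1 := hB f hf hfK hfH m
  have h2 := hB g hg hgK hgH m
  have h3 := abs_jacPairing_sub_le hχ hc i₀
    (f := fun i => mollify ε (f i)) (g := fun i => mollify ε (g i))
    (fun i => contDiff_mollify (hf i).continuous _)
    (fun i => contDiff_mollify (hg i).continuous _) (A := A)
    (fun i y => (hfH i).norm_fderiv_mollify_le hσ hε0 y)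
    (fun i y => (hgH i).norm_fderiv_mollify_le hσ hε0 y)
    (fun i y => norm_mollify_sub_mollify_le (hf i).continuous (hg i).continuous (hfg i) ε y)
  rw [← hcd] at h3
  have h4 : c * (η / 3 / (c * A ^ (n - 1) + 1) * A ^ (n - 1)) ≤ η / 3 := by
    have hp : 0 < c * A ^ (n - 1) + 1 := by positivity
    rw [show c * (η / 3 / (c * A ^ (n - 1) + 1) * A ^ (n - 1)) =
      η / 3 * ((c * A ^ (n - 1)) / (c * A ^ (n - 1) + 1)) by ring]
    exact mul_le_of_le_one_right (by positivity) ((div_le_one hp).2 (by linarith))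
  rw [abs_le] at h1 h2 h3 ⊢
  constructor <;> linarith [h1.1, h1.2, h2.1, h2.2, h3.1, h3.2]

end HolderContinuityOfPairing

/-! ### Extension from the sphere to Euclidean space -/

open Classical in
/-- The `0`-homogeneous extension of a map on the sphere with values in any vector space. -/
noncomputable def radialExtension {k : ℕ} {V : Type*} [Zero V] (ψ : UnitSphere k → V)
    (y : EuclideanSpace ℝ (Fin (k + 1))) : V :=
  if hy : y ≠ 0 then ψ (radialRetraction y hy) else 0

/-- A smooth cutoff which is `1` for `1/2 ≤ |y|² ≤ 3` and `0` for `|y| ≤ 1/2` or `|y| ≥ 2`. -/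
noncomputable def collarCutoff {k : ℕ} (y : EuclideanSpace ℝ (Fin (k + 1))) : ℝ :=
  Real.smoothTransition (4 * ‖y‖ ^ 2 - 1) * Real.smoothTransition (4 - ‖y‖ ^ 2)

/-- The extension of a map on the sphere that is `0`-homogeneous near the sphere and cut off
away from it. -/
noncomputable def collarExtension {k : ℕ} {V : Type*} [NormedAddCommGroup V] [NormedSpace ℝ V]
    (ψ : UnitSphere k → V) (y : EuclideanSpace ℝ (Fin (k + 1))) : V :=
  collarCutoff y • radialExtension ψ y

section CollarExtension

variable {k : ℕ} {V : Type*} [NormedAddCommGroup V] [NormedSpace ℝ V]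

lemma homogeneousExtension_eq_radialExtension {N : ℕ}
    (ψ : UnitSphere k → EuclideanSpace ℝ (Fin N)) :
    homogeneousExtension ψ = radialExtension ψ := rfl

omit [NormedSpace ℝ V] in
lemma radialExtension_of_ne_zero (ψ : UnitSphere k → V) {y : EuclideanSpace ℝ (Fin (k + 1))}
    (hy : y ≠ 0) : radialExtension ψ y = ψ (radialRetraction y hy) := dif_pos hy

lemma UnitSphere.coe_ne_zero (x : UnitSphere k) : (x : EuclideanSpace ℝ (Fin (k + 1))) ≠ 0 :=
  ne_zero_of_mem_unit_sphere x

omit [NormedSpace ℝ V] in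
lemma radialExtension_smul (ψ : UnitSphere k → V) {r : ℝ} (hr : 0 < r)
    (y : EuclideanSpace ℝ (Fin (k + 1))) : radialExtension ψ (r • y) = radialExtension ψ y := by
  by_cases hy : y = 0
  · simp [hy]
  · have hry : r • y ≠ 0 := smul_ne_zero hr.ne' hy
    rw [radialExtension_of_ne_zero ψ hry, radialExtension_of_ne_zero ψ hy]
    congr 1
    apply Subtype.ext
    simp only [radialRetraction, norm_smul, Real.norm_of_nonneg hr.le, mul_inv, smul_smul]
    congr 1
    field_simp

omit [NormedSpace ℝ V] in
lemma radialExtension_coe (ψ : UnitSphere k → V) (x : UnitSphere k) :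
    radialExtension ψ (x : EuclideanSpace ℝ (Fin (k + 1))) = ψ x := by
  rw [radialExtension_of_ne_zero ψ x.coe_ne_zero]
  congr 1
  apply Subtype.ext
  simp [radialRetraction]

/-- Away from the origin the extension is `ψ` composed with the smooth retraction of the open
submanifold `{0}ᶜ` onto the sphere. -/
lemma contDiffAt_radialExtension {ψ : UnitSphere k → V}
    (hψ : ContMDiff (𝓡 k) 𝓘(ℝ, V) ∞ ψ) {y : EuclideanSpace ℝ (Fin (k + 1))} (hy : y ≠ 0) :
    ContDiffAt ℝ ∞ (radialExtension ψ) y := by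
  let U : TopologicalSpace.Opens (EuclideanSpace ℝ (Fin (k + 1))) :=
    ⟨{0}ᶜ, isOpen_compl_singleton⟩
  have h1 : ContMDiff 𝓘(ℝ, EuclideanSpace ℝ (Fin (k + 1))) 𝓘(ℝ, EuclideanSpace ℝ (Fin (k + 1))) ∞
      (fun u : U => ‖(u : EuclideanSpace ℝ (Fin (k + 1)))‖⁻¹ •
        (u : EuclideanSpace ℝ (Fin (k + 1)))) := by
    intro u
    have hu : (u : EuclideanSpace ℝ (Fin (k + 1))) ≠ 0 := u.2
    refine (contMDiffAt_subtype_iff (f := fun z : EuclideanSpace ℝ (Fin (k + 1)) =>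
      ‖z‖⁻¹ • z)).2 (ContDiffAt.contMDiffAt ?_)
    exact ((contDiffAt_norm ℝ hu).inv (norm_ne_zero_iff.2 hu)).smul contDiffAt_id
  have hmem : ∀ u : U, ‖(u : EuclideanSpace ℝ (Fin (k + 1)))‖⁻¹ •
      (u : EuclideanSpace ℝ (Fin (k + 1))) ∈
      Metric.sphere (0 : EuclideanSpace ℝ (Fin (k + 1))) 1 := fun u =>
    (radialRetraction (u : EuclideanSpace ℝ (Fin (k + 1))) u.2).2
  have := Fact.mk (finrank_euclideanSpace_fin (𝕜 := ℝ) (n := k + 1))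
  have h2 := hψ.comp (h1.codRestrict_sphere hmem)
  have h3 : ContMDiffAt 𝓘(ℝ, EuclideanSpace ℝ (Fin (k + 1))) 𝓘(ℝ, V) ∞
      (fun u : U => radialExtension ψ u) ⟨y, hy⟩ := by
    convert h2 ⟨y, hy⟩ using 1
    funext u
    exact radialExtension_of_ne_zero ψ u.2
  exact (contMDiffAt_subtype_iff.1 h3).contDiffAt

lemma contDiff_collarCutoff : ContDiff ℝ ∞ (collarCutoff (k := k)) := by
  have hn : ContDiff ℝ ∞ fun y : EuclideanSpace ℝ (Fin (k + 1)) => ‖y‖ ^ 2 := contDiff_norm_sq ℝ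
  exact (Real.smoothTransition.contDiff.comp ((contDiff_const.mul hn).sub contDiff_const)).mul
    (Real.smoothTransition.contDiff.comp (contDiff_const.sub hn))

lemma collarCutoff_nonneg (y : EuclideanSpace ℝ (Fin (k + 1))) : 0 ≤ collarCutoff y :=
  mul_nonneg (Real.smoothTransition.nonneg _) (Real.smoothTransition.nonneg _)

lemma collarCutoff_le_one (y : EuclideanSpace ℝ (Fin (k + 1))) : collarCutoff y ≤ 1 :=
  mul_le_one₀ (Real.smoothTransition.le_one _) (Real.smoothTransition.nonneg _)
    (Real.smoothTransition.le_one _)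

lemma collarCutoff_eq_zero_of_norm_le {y : EuclideanSpace ℝ (Fin (k + 1))} (hy : ‖y‖ ≤ 1 / 2) :
    collarCutoff y = 0 := by
  unfold collarCutoff
  rw [Real.smoothTransition.zero_of_nonpos (by nlinarith [norm_nonneg y]), zero_mul]

lemma collarCutoff_eq_zero_of_le_norm {y : EuclideanSpace ℝ (Fin (k + 1))} (hy : 2 ≤ ‖y‖) :
    collarCutoff y = 0 := by
  unfold collarCutoff
  rw [Real.smoothTransition.zero_of_nonpos (x := 4 - ‖y‖ ^ 2) (by nlinarith), mul_zero]

lemma collarCutoff_eq_one {y : EuclideanSpace ℝ (Fin (k + 1))} (h1 : 1 / 2 ≤ ‖y‖ ^ 2)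
    (h2 : ‖y‖ ^ 2 ≤ 3) : collarCutoff y = 1 := by
  unfold collarCutoff
  rw [Real.smoothTransition.one_of_one_le (by linarith),
    Real.smoothTransition.one_of_one_le (by linarith), one_mul]

lemma hasCompactSupport_collarCutoff : HasCompactSupport (collarCutoff (k := k)) := by
  refine HasCompactSupport.intro (isCompact_closedBall 0 2) fun y hy => ?_
  refine collarCutoff_eq_zero_of_le_norm ?_
  simpa using (not_le.1 (by simpa using hy)).le

lemma hasCompactSupport_collarExtension (ψ : UnitSphere k → V) :
    HasCompactSupport (collarExtension ψ) :=
  hasCompactSupport_collarCutoff.smul_right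

lemma contDiff_collarExtension {ψ : UnitSphere k → V} (hψ : ContMDiff (𝓡 k) 𝓘(ℝ, V) ∞ ψ) :
    ContDiff ℝ ∞ (collarExtension ψ) := by
  rw [contDiff_iff_contDiffAt]
  intro y
  by_cases hy : y = 0
  · subst hy
    have : collarExtension ψ =ᶠ[𝓝 0] fun _ => 0 := by
      filter_upwards [Metric.ball_mem_nhds (0 : EuclideanSpace ℝ (Fin (k + 1)))
        (by norm_num : (0 : ℝ) < 1 / 2)] with z hz
      rw [collarExtension,
        collarCutoff_eq_zero_of_norm_le (by simpa using (Metric.mem_ball.1 hz).le), zero_smul]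
    exact contDiffAt_const.congr_of_eventuallyEq this
  · exact contDiff_collarCutoff.contDiffAt.smul (contDiffAt_radialExtension hψ hy)

lemma collarExtension_eventuallyEq (ψ : UnitSphere k → V) {y : EuclideanSpace ℝ (Fin (k + 1))}
    (h1 : 1 / 2 < ‖y‖ ^ 2) (h2 : ‖y‖ ^ 2 < 3) :
    collarExtension ψ =ᶠ[𝓝 y] radialExtension ψ := by
  have hn : ContinuousAt (fun z : EuclideanSpace ℝ (Fin (k + 1)) => ‖z‖ ^ 2) y := by fun_prop
  filter_upwards [hn.eventually (lt_mem_nhds h1), hn.eventually (gt_mem_nhds h2)] with z hz1 hz2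
  rw [collarExtension, collarCutoff_eq_one hz1.le hz2.le, one_smul]

lemma collarExtension_coe (ψ : UnitSphere k → V) (x : UnitSphere k) :
    collarExtension ψ (x : EuclideanSpace ℝ (Fin (k + 1))) = ψ x := by
  have hx : ‖(x : EuclideanSpace ℝ (Fin (k + 1)))‖ = 1 := norm_eq_of_mem_sphere x
  rw [(collarExtension_eventuallyEq ψ (by rw [hx]; norm_num) (by rw [hx]; norm_num)).eq_of_nhds,
    radialExtension_coe]

lemma norm_collarExtension_sub_le {ψ₁ ψ₂ : UnitSphere k → V} {δ : ℝ} (hδ : 0 ≤ δ)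
    (h : ∀ x, ‖ψ₁ x - ψ₂ x‖ ≤ δ) (y : EuclideanSpace ℝ (Fin (k + 1))) :
    ‖collarExtension ψ₁ y - collarExtension ψ₂ y‖ ≤ δ := by
  unfold collarExtension
  rw [← smul_sub, norm_smul, Real.norm_of_nonneg (collarCutoff_nonneg y)]
  by_cases hy : y = 0
  · simp [hy, radialExtension, hδ]
  · rw [radialExtension_of_ne_zero ψ₁ hy, radialExtension_of_ne_zero ψ₂ hy]
    exact (mul_le_of_le_one_left (norm_nonneg _) (collarCutoff_le_one y)).trans (h _)

/-- The retraction has Lipschitz factor at most `2 / ‖x‖` between `x` and any nonzero `y`, hence `4`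
under the bound on `‖x‖`. -/
lemma dist_radialRetraction_le {x y : EuclideanSpace ℝ (Fin (k + 1))} (hx : 1 / 2 < ‖x‖)
    (hx0 : x ≠ 0) (hy0 : y ≠ 0) :
    dist (radialRetraction x hx0) (radialRetraction y hy0) ≤ 4 * dist x y := by
  rw [Subtype.dist_eq, dist_eq_norm, dist_eq_norm]
  change ‖‖x‖⁻¹ • x - ‖y‖⁻¹ • y‖ ≤ 4 * ‖x - y‖
  have hxp := norm_pos_iff.2 hx0
  have hyp := norm_pos_iff.2 hy0
  have e : ‖x‖⁻¹ • x - ‖y‖⁻¹ • y = ‖x‖⁻¹ • (x - y) + (‖x‖⁻¹ - ‖y‖⁻¹) • y := by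
    rw [smul_sub, sub_smul]; abel
  have h1 : ‖(‖x‖⁻¹ - ‖y‖⁻¹) • y‖ ≤ ‖x‖⁻¹ * ‖x - y‖ := by
    rw [norm_smul, Real.norm_eq_abs]
    have : ‖x‖⁻¹ - ‖y‖⁻¹ = ‖x‖⁻¹ * ‖y‖⁻¹ * (‖y‖ - ‖x‖) := by field_simp
    rw [this, abs_mul, abs_of_pos (by positivity)]
    have h2 := abs_norm_sub_norm_le y x
    rw [norm_sub_rev] at h2
    calc _ = ‖x‖⁻¹ * |‖y‖ - ‖x‖| := by field_simp
      _ ≤ _ := by gcongr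
  have h3 : ‖x‖⁻¹ ≤ 2 := by
    rw [inv_le_comm₀ hxp (by norm_num)]; linarith
  rw [e]
  refine (norm_add_le _ _).trans ?_
  rw [norm_smul, Real.norm_of_nonneg (inv_pos.2 hxp).le]
  nlinarith [mul_le_mul_of_nonneg_right h3 (norm_nonneg (x - y))]

/-- At distance at most one the Lipschitz bound suffices, and beyond that the bound `0 ≤
collarCutoff ≤ 1`; so `L` is independent of `σ`. -/
lemma exists_holderWith_collarCutoff (k : ℕ) :
    ∃ L : ℝ, 0 ≤ L ∧ ∀ σ : ℝ≥0, σ ≤ 1 → ∀ x y : EuclideanSpace ℝ (Fin (k + 1)),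
      |collarCutoff x - collarCutoff y| ≤ L * dist x y ^ (σ : ℝ) := by
  obtain ⟨K, hK⟩ := ContDiff.lipschitzWith_of_hasCompactSupport
    (hasCompactSupport_collarCutoff (k := k)) contDiff_collarCutoff (by simp)
  refine ⟨K + 1, by positivity, fun σ hσ x y => ?_⟩
  have h := hK.dist_le_mul x y
  rw [Real.dist_eq] at h
  rcases le_total (dist x y) 1 with hd | hd
  · have : dist x y ≤ dist x y ^ (σ : ℝ) := by
      rcases eq_or_lt_of_le (dist_nonneg (x := x) (y := y)) with h0 | h0
      · rw [← h0]; positivity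
      · simpa using Real.rpow_le_rpow_of_exponent_ge h0 hd (show (σ : ℝ) ≤ 1 by exact_mod_cast hσ)
    have h2 : (K : ℝ) * dist x y ≤ K * dist x y ^ (σ : ℝ) := mul_le_mul_of_nonneg_left this K.2
    have h3 : 0 ≤ dist x y ^ (σ : ℝ) := by positivity
    linarith
  · have h1 : 1 ≤ dist x y ^ (σ : ℝ) := Real.one_le_rpow hd σ.2
    have h2 : |collarCutoff x - collarCutoff y| ≤ 1 := by
      rw [abs_le]
      constructor <;> linarith [collarCutoff_nonneg x, collarCutoff_nonneg y,
        collarCutoff_le_one x, collarCutoff_le_one y]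
    have h3 : 0 ≤ (K : ℝ) * dist x y ^ (σ : ℝ) := by positivity
    linarith

/-- The collar extension preserves Hölder bounds. -/
lemma exists_holderWith_collarExtension (k : ℕ) {σ : ℝ≥0} (hσ : σ ≤ 1) (C B : ℝ≥0) :
    ∃ C' : ℝ≥0, ∀ {V : Type} [NormedAddCommGroup V] [NormedSpace ℝ V] (ψ : UnitSphere k → V),
      HolderWith C σ ψ → (∀ x, ‖ψ x‖ ≤ B) → HolderWith C' σ (collarExtension ψ) := by
  obtain ⟨L, hL0, hL⟩ := exists_holderWith_collarCutoff k
  refine ⟨⟨4 * C + L * B, by positivity⟩, ?_⟩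
  intro V _ _ ψ hψ hB
  have hBy : ∀ y, ‖radialExtension ψ y‖ ≤ B := by
    intro y
    by_cases hy : y = 0
    · simp [hy, radialExtension]
    · rw [radialExtension_of_ne_zero ψ hy]; exact hB _
  have hcut : ∀ x y, |collarCutoff x - collarCutoff y| * ‖radialExtension ψ y‖ ≤
      L * B * dist x y ^ (σ : ℝ) := by
    intro x y
    calc _ ≤ (L * dist x y ^ (σ : ℝ)) * B :=
          mul_le_mul (hL σ hσ x y) (hBy y) (norm_nonneg _) (by positivity)
      _ = _ := by ring
  refine HolderWith.of_dist_le fun x y => ?_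
  have hC0 : 0 ≤ 4 * (C : ℝ) * dist x y ^ (σ : ℝ) := by positivity
  change dist _ _ ≤ (4 * C + L * B) * dist x y ^ (σ : ℝ)
  rw [dist_eq_norm, add_mul]
  unfold collarExtension
  -- The retraction is not uniformly Lipschitz near the origin, but the cutoff vanishes for norm at
  -- most `1 / 2`. If one point lies there, the variation of the cutoff alone controls the
  -- difference.
  rcases le_or_gt ‖x‖ (1 / 2) with hx | hx
  · have h := hcut x y
    rw [collarCutoff_eq_zero_of_norm_le hx] at h ⊢
    rw [zero_smul, zero_sub, norm_neg, norm_smul, Real.norm_eq_abs]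
    rw [zero_sub, abs_neg] at h
    linarith
  rcases le_or_gt ‖y‖ (1 / 2) with hy | hy
  · have h := hcut y x
    rw [collarCutoff_eq_zero_of_norm_le hy] at h ⊢
    rw [zero_smul, sub_zero, norm_smul, Real.norm_eq_abs]
    rw [zero_sub, abs_neg, dist_comm] at h
    linarith
  · have hx0 : x ≠ 0 := fun h => by rw [h, norm_zero] at hx; linarith
    have hy0 : y ≠ 0 := fun h => by rw [h, norm_zero] at hy; linarith
    have e : collarCutoff x • radialExtension ψ x - collarCutoff y • radialExtension ψ y =
        collarCutoff x • (radialExtension ψ x - radialExtension ψ y) +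
          (collarCutoff x - collarCutoff y) • radialExtension ψ y := by
      rw [smul_sub, sub_smul]; abel
    rw [e]
    refine (norm_add_le _ _).trans (add_le_add ?_ ?_)
    · rw [norm_smul, Real.norm_of_nonneg (collarCutoff_nonneg x)]
      refine (mul_le_of_le_one_left (norm_nonneg _) (collarCutoff_le_one x)).trans ?_
      rw [radialExtension_of_ne_zero ψ hx0, radialExtension_of_ne_zero ψ hy0, ← dist_eq_norm]
      refine (hψ.dist_le_of_le (dist_radialRetraction_le hx hx0 hy0)).trans ?_
      rw [Real.mul_rpow (by norm_num) dist_nonneg]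
      have h4 : (4 : ℝ) ^ (σ : ℝ) ≤ 4 := by
        simpa using Real.rpow_le_rpow_of_exponent_le (by norm_num : (1 : ℝ) ≤ 4)
          (show (σ : ℝ) ≤ 1 by exact_mod_cast hσ)
      calc (C : ℝ) * (4 ^ (σ : ℝ) * dist x y ^ (σ : ℝ)) ≤ C * (4 * dist x y ^ (σ : ℝ)) := by gcongr
        _ = _ := by ring
    · rw [norm_smul, Real.norm_eq_abs]
      exact hcut x y

lemma exists_lipschitzWith_collarExtension {ψ : UnitSphere k → V}
    (hψ : ContMDiff (𝓡 k) 𝓘(ℝ, V) ∞ ψ) : ∃ K, LipschitzWith K (collarExtension ψ) :=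
  ContDiff.lipschitzWith_of_hasCompactSupport (hasCompactSupport_collarExtension ψ)
    (contDiff_collarExtension hψ) (by simp)

end CollarExtension

/-! ### Polar coordinates: from the sphere to the pairing -/

/-- The smooth radial function which is `1` for `|y| ≤ 1` and `0` for `|y|² ≥ 2`. -/
noncomputable def radialStep {k : ℕ} (y : EuclideanSpace ℝ (Fin (k + 1))) : ℝ :=
  Real.smoothTransition (2 - ‖y‖ ^ 2)

section PolarCoordinates

variable {k : ℕ}

/-- Polar coordinates for a product of a radial and an angular function. -/
lemma integral_eq_mul_of_polar {F : EuclideanSpace ℝ (Fin (k + 1)) → ℝ} {h : ℝ → ℝ}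
    {G : UnitSphere k → ℝ} (hF : ∀ r > 0, ∀ x : UnitSphere k,
      F (r • (x : EuclideanSpace ℝ (Fin (k + 1)))) = h r * G x) :
    ∫ y, F y = (∫ r in Set.Ioi (0 : ℝ), r ^ k * h r) *
      ∫ x, G x ∂(volume : Measure (EuclideanSpace ℝ (Fin (k + 1)))).toSphere := by
  have hdim : Module.finrank ℝ (EuclideanSpace ℝ (Fin (k + 1))) - 1 = k := by simp
  set μ : Measure (EuclideanSpace ℝ (Fin (k + 1))) := volume
  calc ∫ y, F y
    _ = ∫ y : ({(0)}ᶜ : Set (EuclideanSpace ℝ (Fin (k + 1)))), F y ∂(μ.comap (↑)) := by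
      rw [integral_subtype_comap (measurableSet_singleton _).compl fun x => F x,
        restrict_compl_singleton]
    _ = ∫ p, G p.1 * h (p.2 : ℝ) ∂μ.toSphere.prod (.volumeIoiPow k) := by
      have := μ.measurePreserving_homeomorphUnitSphereProd.integral_comp
        (Homeomorph.measurableEmbedding _) (fun p => G p.1 * h (p.2 : ℝ))
      rw [hdim] at this
      rw [← this]
      refine integral_congr_ae (ae_of_all _ fun y => ?_)
      have hy : 0 < ‖(y : EuclideanSpace ℝ (Fin (k + 1)))‖ := norm_pos_iff.2 y.2
      have hy2 := hF _ hy ((homeomorphUnitSphereProd _ y).1)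
      simp only [homeomorphUnitSphereProd_apply_fst_coe, smul_inv_smul₀ hy.ne'] at hy2
      simp only [homeomorphUnitSphereProd_apply_snd_coe]
      rw [hy2, mul_comm]
    _ = (∫ x, G x ∂μ.toSphere) * ∫ r : Set.Ioi (0 : ℝ), h r ∂.volumeIoiPow k :=
      integral_prod_mul G fun r : Set.Ioi (0 : ℝ) => h r
    _ = _ := by
      rw [mul_comm]
      congr 1
      simp only [Measure.volumeIoiPow, ENNReal.ofReal]
      rw [integral_withDensity_eq_integral_smul,
        integral_subtype_comap measurableSet_Ioi fun a => Real.toNNReal (a ^ k) • h a,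
        setIntegral_congr_fun measurableSet_Ioi fun x hx => ?_]
      · rw [NNReal.smul_def, Real.coe_toNNReal _ (pow_nonneg (Set.mem_Ioi.1 hx).le _), smul_eq_mul]
      · exact (measurable_subtype_coe.pow_const _).real_toNNReal

lemma contDiff_radialStep : ContDiff ℝ ∞ (radialStep (k := k)) :=
  Real.smoothTransition.contDiff.comp (contDiff_const.sub (contDiff_norm_sq ℝ))

lemma hasCompactSupport_radialStep : HasCompactSupport (radialStep (k := k)) := by
  refine HasCompactSupport.intro (isCompact_closedBall 0 2) fun y hy => ?_
  have hy' : 2 < ‖y‖ := by simpa using hy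
  exact Real.smoothTransition.zero_of_nonpos (by nlinarith)

lemma hasDerivAt_smoothTransition (x : ℝ) :
    HasDerivAt Real.smoothTransition (deriv Real.smoothTransition x) x :=
  ((Real.smoothTransition.contDiff (n := 1)).differentiable (by simp) x).hasDerivAt

lemma deriv_smoothTransition_eq_zero {x : ℝ} (hx : x < 0 ∨ 1 < x) :
    deriv Real.smoothTransition x = 0 := by
  rcases hx with hx | hx
  · have : Real.smoothTransition =ᶠ[𝓝 x] fun _ => 0 := by
      filter_upwards [gt_mem_nhds hx] with z hz
      exact Real.smoothTransition.zero_of_nonpos (le_of_lt hz)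
    rw [this.deriv_eq, deriv_const]
  · have : Real.smoothTransition =ᶠ[𝓝 x] fun _ => 1 := by
      filter_upwards [lt_mem_nhds hx] with z hz
      exact Real.smoothTransition.one_of_one_le (le_of_lt hz)
    rw [this.deriv_eq, deriv_const]

lemma gradRow_radialStep (y : EuclideanSpace ℝ (Fin (k + 1))) :
    gradRow radialStep y = (-2 * deriv Real.smoothTransition (2 - ‖y‖ ^ 2)) • fun c => y c := by
  have h1 : HasFDerivAt (fun z : EuclideanSpace ℝ (Fin (k + 1)) => 2 - ‖z‖ ^ 2)
      (-(2 • (innerSL ℝ y))) y := (hasStrictFDerivAt_norm_sq y).hasFDerivAt.const_sub 2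
  have h2 : HasFDerivAt (radialStep (k := k)) _ y :=
    (hasDerivAt_smoothTransition (2 - ‖y‖ ^ 2)).comp_hasFDerivAt y h1
  ext c
  rw [gradRow, h2.fderiv]
  simp [EuclideanSpace.inner_single_right]
  ring

/-- The integrand is the radial derivative of `radialStep`, which falls from `1` at the origin to
`0`. This is the source of the sign in `jacPairing_collarExtension`. -/
lemma integral_deriv_smoothTransition :
    ∫ r in Set.Ioi (0 : ℝ), -2 * deriv Real.smoothTransition (2 - r ^ 2) * r = -1 := by
  have hd : ∀ r : ℝ, HasDerivAt (fun r => Real.smoothTransition (2 - r ^ 2))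
      (-2 * deriv Real.smoothTransition (2 - r ^ 2) * r) r := by
    intro r
    have h1 : HasDerivAt (fun r : ℝ => 2 - r ^ 2) (-(2 * r)) r := by
      simpa using (hasDerivAt_pow 2 r).const_sub 2
    have h2 : HasDerivAt (fun r => Real.smoothTransition (2 - r ^ 2))
        (deriv Real.smoothTransition (2 - r ^ 2) * -(2 * r)) r :=
      HasDerivAt.comp (h₂ := Real.smoothTransition) (h := fun r => 2 - r ^ 2) r
        (hasDerivAt_smoothTransition (2 - r ^ 2)) h1
    exact h2.congr_deriv (by ring)
  have hcont : Continuous fun r : ℝ => -2 * deriv Real.smoothTransition (2 - r ^ 2) * r := by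
    have : Continuous (deriv Real.smoothTransition) :=
      (Real.smoothTransition.contDiff (n := 1)).continuous_deriv (by simp)
    fun_prop
  have hcs : HasCompactSupport fun r : ℝ => -2 * deriv Real.smoothTransition (2 - r ^ 2) * r := by
    refine HasCompactSupport.intro (isCompact_closedBall 0 2) fun r hr => ?_
    have hr' : 2 < |r| := by simpa using hr
    rw [deriv_smoothTransition_eq_zero (Or.inl (by nlinarith [sq_abs r])), mul_zero, zero_mul]
  have hlim : Tendsto (fun r : ℝ => Real.smoothTransition (2 - r ^ 2)) atTop (𝓝 0) := by
    refine tendsto_const_nhds.congr' ?_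
    filter_upwards [eventually_ge_atTop 2] with r hr
    rw [Real.smoothTransition.zero_of_nonpos (by nlinarith)]
  rw [integral_Ioi_of_hasDerivAt_of_tendsto' (fun r _ => hd r)
    (hcont.integrable_of_hasCompactSupport hcs).integrableOn hlim,
    Real.smoothTransition.one_of_one_le (by norm_num)]
  norm_num

lemma gradRow_radialExtension_smul (ψ : UnitSphere k → ℝ) {r : ℝ} (hr : 0 < r)
    (y : EuclideanSpace ℝ (Fin (k + 1))) :
    gradRow (radialExtension ψ) (r • y) = r⁻¹ • gradRow (radialExtension ψ) y := by
  have h : (fun z => radialExtension ψ (r • z)) = radialExtension ψ :=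
    funext fun z => radialExtension_smul ψ hr z
  have h2 := fderiv_comp_smul (𝕜 := ℝ) (f := radialExtension ψ) (x := y) r
  rw [h] at h2
  ext c
  simp only [gradRow, Pi.smul_apply, h2, smul_apply]
  rw [inv_smul_smul₀ hr.ne']

/-- The integral of `ψ₀ dψ₁ ∧ ⋯ ∧ dψ_k` over the sphere as an integral over Euclidean space. -/
theorem jacPairing_collarExtension (ψ : Fin (k + 1) → UnitSphere k → ℝ) :
    jacPairing radialStep 0 (fun i => collarExtension (ψ i)) =
      -∫ x : UnitSphere k, ψ 0 x * Matrix.det (Function.update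
        (fun i => gradRow (radialExtension (ψ i)) (x : EuclideanSpace ℝ (Fin (k + 1)))) 0
        (fun c => (x : EuclideanSpace ℝ (Fin (k + 1))) c))
        ∂(volume : Measure (EuclideanSpace ℝ (Fin (k + 1)))).toSphere := by
  have key := integral_eq_mul_of_polar (k := k)
    (F := fun y => collarExtension (ψ 0) y *
      jacDet (Function.update (fun i => collarExtension (ψ i)) 0 radialStep) y)
    -- At `r • x` the gradient of `radialStep` is the first factor times `x`. The other `k` rows are
    -- homogeneous of degree `-1`, and their factor `(r⁻¹) ^ k` cancels the polar weight `r ^ k`.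
    (h := fun r => (-2 * deriv Real.smoothTransition (2 - r ^ 2) * r) * (r⁻¹) ^ k)
    (G := fun x => ψ 0 x * Matrix.det (Function.update
        (fun i => gradRow (radialExtension (ψ i)) (x : EuclideanSpace ℝ (Fin (k + 1)))) 0
        (fun c => (x : EuclideanSpace ℝ (Fin (k + 1))) c))) ?_
  · unfold jacPairing
    rw [key, setIntegral_congr_fun (g := fun r : ℝ =>
      -2 * deriv Real.smoothTransition (2 - r ^ 2) * r) measurableSet_Ioi fun r hr => ?_,
      integral_deriv_smoothTransition, neg_one_mul]
    have hr0 : r ≠ 0 := (Set.mem_Ioi.1 hr).ne'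
    change r ^ k * ((-2 * deriv Real.smoothTransition (2 - r ^ 2) * r) * (r⁻¹) ^ k) = _
    rw [mul_comm, mul_assoc, ← mul_pow, inv_mul_cancel₀ hr0, one_pow, mul_one]
  · intro r hr x
    have hx : ‖(x : EuclideanSpace ℝ (Fin (k + 1)))‖ = 1 := norm_eq_of_mem_sphere x
    have hrx : ‖r • (x : EuclideanSpace ℝ (Fin (k + 1)))‖ = r := by
      rw [norm_smul, hx, mul_one, Real.norm_of_nonneg hr.le]
    simp only
    rw [jacDet_update, gradRow_radialStep, hrx]
    -- Where the derivative is nonzero, `1 ≤ r ^ 2 ≤ 2`. There `collarCutoff` is one, so the collar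
    -- extension coincides with the homogeneous one.
    by_cases hT : deriv Real.smoothTransition (2 - r ^ 2) = 0
    · rw [hT]
      simp only [mul_zero, zero_mul, zero_smul]
      rw [show Matrix.det (Function.update (fun j => gradRow (collarExtension (ψ j))
        (r • (x : EuclideanSpace ℝ (Fin (k + 1))))) 0 0) = 0 from
        (detRowCMM (k + 1)).toMultilinearMap.map_update_zero _ _, mul_zero]
    · have h1 : 1 ≤ r ^ 2 := by
        by_contra h
        exact hT (deriv_smoothTransition_eq_zero (Or.inr (by linarith)))
      have h2 : r ^ 2 ≤ 2 := by
        by_contra h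
        exact hT (deriv_smoothTransition_eq_zero (Or.inl (by linarith)))
      have heq : ∀ i, collarExtension (ψ i) =ᶠ[𝓝 (r • (x : EuclideanSpace ℝ (Fin (k + 1))))]
          radialExtension (ψ i) := fun i =>
        collarExtension_eventuallyEq (ψ i) (by rw [hrx]; linarith) (by rw [hrx]; linarith)
      have hgrad : ∀ i, gradRow (collarExtension (ψ i))
          (r • (x : EuclideanSpace ℝ (Fin (k + 1)))) =
          r⁻¹ • gradRow (radialExtension (ψ i)) (x : EuclideanSpace ℝ (Fin (k + 1))) := by
        intro i
        rw [← gradRow_radialExtension_smul (ψ i) hr]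
        ext c
        simp only [gradRow, (heq i).fderiv_eq]
      rw [(heq 0).eq_of_nhds, radialExtension_smul _ hr, radialExtension_coe]
      simp_rw [hgrad]
      set M := Function.update
        (fun i => gradRow (radialExtension (ψ i)) (x : EuclideanSpace ℝ (Fin (k + 1)))) 0
        (fun c => (x : EuclideanSpace ℝ (Fin (k + 1))) c) with hM
      have hrows : Function.update
          (fun j => r⁻¹ • gradRow (radialExtension (ψ j)) (x : EuclideanSpace ℝ (Fin (k + 1)))) 0
          ((-2 * deriv Real.smoothTransition (2 - r ^ 2)) •
            fun c => (r • (x : EuclideanSpace ℝ (Fin (k + 1)))) c) =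
          fun i => (Fin.cons (-2 * deriv Real.smoothTransition (2 - r ^ 2) * r)
            (fun _ : Fin k => r⁻¹) : Fin (k + 1) → ℝ) i • M i := by
        funext i
        refine Fin.cases ?_ (fun j => ?_) i
        · ext c
          simp [hM]; ring
        · simp [hM]
      rw [hrows]
      have hsm := (detRowCMM (k + 1)).toMultilinearMap.map_smul_univ
        (Fin.cons (-2 * deriv Real.smoothTransition (2 - r ^ 2) * r)
            (fun _ : Fin k => r⁻¹) : Fin (k + 1) → ℝ) M
      rw [show Matrix.det (fun i => (Fin.cons (-2 * deriv Real.smoothTransition (2 - r ^ 2) * r)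
            (fun _ : Fin k => r⁻¹) : Fin (k + 1) → ℝ) i • M i) = _ from hsm, Fin.prod_univ_succ]
      simp only [Fin.cons_zero, Fin.cons_succ, Finset.prod_const, Finset.card_univ,
        Fintype.card_fin, smul_eq_mul]
      change _ * (_ * Matrix.det M) = _
      ring

end PolarCoordinates

/-! ### The pullback integral as a sum of pairings -/

/-- The scalar functions `a_I ∘ ψ, ψ_{I 0}, …, ψ_{I (k - 1)}`, where `a_I` is the coefficient of `w`
with multi-index `I`. -/
noncomputable def coefficientTuple {k N : ℕ}
    (w : EuclideanSpace ℝ (Fin N) → EuclideanSpace ℝ (Fin N) [⋀^Fin k]→L[ℝ] ℝ)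
    (I : Fin k → Fin N) (ψ : UnitSphere k → EuclideanSpace ℝ (Fin N)) :
    Fin (k + 1) → UnitSphere k → ℝ :=
  Fin.cons (fun x => w (ψ x) fun j => EuclideanSpace.single (I j) 1) fun l x => ψ x (I l)

section PullbackIntegral

variable {k N : ℕ}

lemma alternating_apply_eq_sum (β : EuclideanSpace ℝ (Fin N) [⋀^Fin k]→L[ℝ] ℝ)
    (v : Fin k → EuclideanSpace ℝ (Fin N)) :
    β v = ∑ I : Fin k → Fin N, (∏ j, v j (I j)) * β fun j => EuclideanSpace.single (I j) 1 := by
  have hv : v = fun j => ∑ i, v j i • EuclideanSpace.single i (1 : ℝ) := by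
    funext j
    ext i
    simp [Pi.single_apply]
  have h := β.toMultilinearMap.map_sum fun (j : Fin k) (i : Fin N) =>
    v j i • EuclideanSpace.single i (1 : ℝ)
  rw [← hv] at h
  refine h.trans (Finset.sum_congr rfl fun I _ => ?_)
  exact β.toMultilinearMap.map_smul_univ (fun j => v j (I j)) _

/-- Expansion of an alternating form in terms of determinants of coordinates. -/
lemma factorial_mul_alternating_apply (β : EuclideanSpace ℝ (Fin N) [⋀^Fin k]→L[ℝ] ℝ)
    (v : Fin k → EuclideanSpace ℝ (Fin N)) :
    (k.factorial : ℝ) * β v = ∑ I : Fin k → Fin N,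
      (β fun j => EuclideanSpace.single (I j) 1) *
        Matrix.det (Matrix.of fun l j => v j (I l)) := by
  have hperm : ∀ s : Equiv.Perm (Fin k), β v = (Equiv.Perm.sign s : ℤ) * β (v ∘ s) := by
    intro s
    have h := β.toAlternatingMap.map_perm v s
    change β (v ∘ s) = Equiv.Perm.sign s • β v at h
    rw [h, Units.smul_def, zsmul_eq_mul, ← mul_assoc, ← Int.cast_mul, ← Units.val_mul,
      Int.units_mul_self]
    simp
  -- Summing over all permutations assembles the determinants; since all multi-indices are allowed,
  -- not only increasing ones, the factor `k!` remains.
  have hsum : (k.factorial : ℝ) * β v =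
      ∑ s : Equiv.Perm (Fin k), ((Equiv.Perm.sign s : ℤ) : ℝ) * β (v ∘ s) := by
    rw [← Finset.sum_congr rfl fun s _ => hperm s]
    simp [Fintype.card_perm]
  rw [hsum]
  simp_rw [alternating_apply_eq_sum β (v ∘ _), Finset.mul_sum]
  rw [Finset.sum_comm]
  refine Finset.sum_congr rfl fun I _ => ?_
  rw [← Matrix.det_transpose, Matrix.det_apply, Finset.mul_sum]
  refine Finset.sum_congr rfl fun s _ => ?_
  rw [Units.smul_def, zsmul_eq_mul]
  simp only [Function.comp_apply, Matrix.transpose_apply, Matrix.of_apply]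
  ring

lemma contMDiff_coefficientTuple
    {w : EuclideanSpace ℝ (Fin N) → EuclideanSpace ℝ (Fin N) [⋀^Fin k]→L[ℝ] ℝ}
    (hw : ContDiff ℝ ∞ w) (I : Fin k → Fin N) {ψ : UnitSphere k → EuclideanSpace ℝ (Fin N)}
    (hψ : ContMDiff (𝓡 k) 𝓘(ℝ, EuclideanSpace ℝ (Fin N)) ∞ ψ) (i : Fin (k + 1)) :
    ContMDiff (𝓡 k) 𝓘(ℝ, ℝ) ∞ (coefficientTuple w I ψ i) := by
  refine Fin.cases ?_ (fun l => ?_) i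
  · have h : ContDiff ℝ ∞ fun z => w z fun j => EuclideanSpace.single (I j) (1 : ℝ) :=
      (ContinuousAlternatingMap.apply ℝ (EuclideanSpace ℝ (Fin N)) ℝ
        (fun j => EuclideanSpace.single (I j) (1 : ℝ))).contDiff.comp hw
    exact h.contMDiff.comp hψ
  · have h : ContDiff ℝ ∞ fun z : EuclideanSpace ℝ (Fin N) => z (I l) := by fun_prop
    exact h.contMDiff.comp hψ

/-- The alternating sum defining `sphereDensity` is the Laplace expansion, along a top row equal to
`x`, of a determinant whose other rows are gradients of the coordinates of `ψ`. -/
lemma sphereDensity_spherePullback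
    (w : EuclideanSpace ℝ (Fin N) → EuclideanSpace ℝ (Fin N) [⋀^Fin k]→L[ℝ] ℝ)
    {ψ : UnitSphere k → EuclideanSpace ℝ (Fin N)}
    (hψ : ContMDiff (𝓡 k) 𝓘(ℝ, EuclideanSpace ℝ (Fin N)) ∞ ψ) (x : UnitSphere k) :
    sphereDensity x (spherePullback ψ w x) = (k.factorial : ℝ)⁻¹ * ∑ I : Fin k → Fin N,
      coefficientTuple w I ψ 0 x * Matrix.det (Function.update
        (fun i => gradRow (radialExtension (coefficientTuple w I ψ i))
          (x : EuclideanSpace ℝ (Fin (k + 1)))) 0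
        (fun c => (x : EuclideanSpace ℝ (Fin (k + 1))) c)) := by
  have hk : (k.factorial : ℝ) ≠ 0 := by positivity
  have hD : DifferentiableAt ℝ (homogeneousExtension ψ) (x : EuclideanSpace ℝ (Fin (k + 1))) :=
    (contDiffAt_radialExtension hψ x.coe_ne_zero).differentiableAt (by simp)
  have hcoord : ∀ (m : Fin N) (c : Fin (k + 1)),
      gradRow (radialExtension fun z => ψ z m) (x : EuclideanSpace ℝ (Fin (k + 1))) c =
        sphereDifferential ψ x (EuclideanSpace.single c 1) m := by
    intro m c
    have h1 : (radialExtension fun z => ψ z m) = fun y => (homogeneousExtension ψ y) m := by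
      funext y
      by_cases hy : y = 0
      · simp [hy, radialExtension, homogeneousExtension]
      · rw [radialExtension_of_ne_zero _ hy, homogeneousExtension_eq_radialExtension,
          radialExtension_of_ne_zero _ hy]
    have h2 := (EuclideanSpace.proj (𝕜 := ℝ) m).hasFDerivAt.comp
      (x : EuclideanSpace ℝ (Fin (k + 1))) hD.hasFDerivAt
    have h3 : HasFDerivAt (fun y => (homogeneousExtension ψ y) m) _
      (x : EuclideanSpace ℝ (Fin (k + 1))) := h2
    rw [gradRow, h1, h3.fderiv]
    rfl
  have hterm : ∀ i : Fin (k + 1), (spherePullback ψ w x fun j =>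
      EuclideanSpace.single (i.succAbove j) 1) = (k.factorial : ℝ)⁻¹ * ∑ I : Fin k → Fin N,
      coefficientTuple w I ψ 0 x * Matrix.det (Matrix.of fun l j =>
        gradRow (radialExtension (coefficientTuple w I ψ (Fin.succ l)))
          (x : EuclideanSpace ℝ (Fin (k + 1))) (i.succAbove j)) := by
    intro i
    rw [eq_inv_mul_iff_mul_eq₀ hk]
    refine (factorial_mul_alternating_apply (w (ψ x)) _).trans ?_
    refine Finset.sum_congr rfl fun I _ => ?_
    congr 2
    ext l j
    exact (hcoord (I l) (i.succAbove j)).symm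
  unfold sphereDensity
  simp_rw [hterm, Finset.mul_sum]
  rw [Finset.sum_comm]
  refine Finset.sum_congr rfl fun I _ => ?_
  have hdet := Matrix.det_succ_row_zero (Matrix.of (Function.update
        (fun i => gradRow (radialExtension (coefficientTuple w I ψ i))
          (x : EuclideanSpace ℝ (Fin (k + 1)))) 0
        (fun c => (x : EuclideanSpace ℝ (Fin (k + 1))) c)))
  refine Eq.trans ?_ (congrArg (fun d => (k.factorial : ℝ)⁻¹ *
    (coefficientTuple w I ψ 0 x * d)) hdet.symm)
  rw [Finset.mul_sum, Finset.mul_sum]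
  refine Finset.sum_congr rfl fun i _ => ?_
  have hsub : Matrix.submatrix (Matrix.of (Function.update
        (fun i => gradRow (radialExtension (coefficientTuple w I ψ i))
          (x : EuclideanSpace ℝ (Fin (k + 1)))) 0
        (fun c => (x : EuclideanSpace ℝ (Fin (k + 1))) c))) Fin.succ i.succAbove =
      Matrix.of fun l j => gradRow (radialExtension (coefficientTuple w I ψ (Fin.succ l)))
          (x : EuclideanSpace ℝ (Fin (k + 1))) (i.succAbove j) := by
    ext l j
    simp
  rw [hsub]
  simp only [Matrix.of_apply, Function.update_self]
  ring

lemma integrable_mul_det_gradRow {ψ : Fin (k + 1) → UnitSphere k → ℝ}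
    (hψ : ∀ i, ContMDiff (𝓡 k) 𝓘(ℝ, ℝ) ∞ (ψ i)) :
    Integrable (fun x : UnitSphere k => ψ 0 x * Matrix.det (Function.update
        (fun i => gradRow (radialExtension (ψ i)) (x : EuclideanSpace ℝ (Fin (k + 1)))) 0
        (fun c => (x : EuclideanSpace ℝ (Fin (k + 1))) c)))
      (volume : Measure (EuclideanSpace ℝ (Fin (k + 1)))).toSphere := by
  have hgrad : ∀ i, Continuous fun x : UnitSphere k =>
      gradRow (radialExtension (ψ i)) (x : EuclideanSpace ℝ (Fin (k + 1))) := by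
    intro i
    have h1 : (fun x : UnitSphere k => gradRow (radialExtension (ψ i))
        (x : EuclideanSpace ℝ (Fin (k + 1)))) = fun x : UnitSphere k =>
        gradRow (collarExtension (ψ i)) (x : EuclideanSpace ℝ (Fin (k + 1))) := by
      funext x
      have hx : ‖(x : EuclideanSpace ℝ (Fin (k + 1)))‖ = 1 := norm_eq_of_mem_sphere x
      ext c
      simp only [gradRow, (collarExtension_eventuallyEq (ψ i)
        (y := (x : EuclideanSpace ℝ (Fin (k + 1))))
        (by rw [hx]; norm_num) (by rw [hx]; norm_num)).fderiv_eq]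
    rw [h1]
    exact (contDiff_gradRow (contDiff_collarExtension (hψ i))).continuous.comp
      continuous_subtype_val
  refine Continuous.integrable_of_hasCompactSupport ?_ (HasCompactSupport.of_compactSpace _)
  refine (hψ 0).continuous.mul (Continuous.matrix_det ?_)
  exact (continuous_pi hgrad).update 0 (by fun_prop)

theorem spherePullbackIntegral_eq_sum_jacPairing
    {w : EuclideanSpace ℝ (Fin N) → EuclideanSpace ℝ (Fin N) [⋀^Fin k]→L[ℝ] ℝ}
    (hw : ContDiff ℝ ∞ w) {ψ : UnitSphere k → EuclideanSpace ℝ (Fin N)}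
    (hψ : ContMDiff (𝓡 k) 𝓘(ℝ, EuclideanSpace ℝ (Fin N)) ∞ ψ) :
    spherePullbackIntegral ψ w = -(k.factorial : ℝ)⁻¹ * ∑ I : Fin k → Fin N,
      jacPairing radialStep 0 fun i => collarExtension (coefficientTuple w I ψ i) := by
  unfold spherePullbackIntegral
  simp_rw [sphereDensity_spherePullback w hψ]
  rw [integral_const_mul, integral_finsetSum _ fun I _ =>
    integrable_mul_det_gradRow (contMDiff_coefficientTuple hw I hψ)]
  simp_rw [jacPairing_collarExtension]
  rw [Finset.sum_neg_distrib]
  ring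

end PullbackIntegral

/-! ### Smooth Hölder approximations -/

section HolderApproximation

variable {k N : ℕ}

lemma exists_norm_le_of_holderWith {σ C : ℝ≥0} (hσ : 0 < σ)
    {φ : UnitSphere k → EuclideanSpace ℝ (Fin N)} (hφ : HolderWith C σ φ) :
    ∃ R : ℝ≥0, ∀ x, ‖φ x‖ ≤ R := by
  obtain ⟨R, hR⟩ := (isCompact_range (hφ.continuous hσ)).isBounded.exists_norm_le
  exact ⟨R.toNNReal, fun x => (hR _ ⟨x, rfl⟩).trans (Real.le_coe_toNNReal R)⟩

/-- Mollification provides smooth `C^σ`-approximations. -/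
lemma exists_isSmoothHolderApprox {σ : ℝ≥0} (hσ : 0 < σ) (hσ1 : σ ≤ 1)
    {φ : UnitSphere k → EuclideanSpace ℝ (Fin N)} (hφ : MemHolder σ φ) :
    ∃ φε : ℝ → UnitSphere k → EuclideanSpace ℝ (Fin N), IsSmoothHolderApprox σ φ φε := by
  obtain ⟨C, hC⟩ := hφ
  obtain ⟨R, hR⟩ := exists_norm_le_of_holderWith hσ hC
  obtain ⟨C', hC'⟩ := exists_holderWith_collarExtension k hσ1 C R
  have hH := hC' φ hC hR
  -- The collar extension is Hölder on the whole space and restricts to `φ`, so its mollifications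
  -- can be restricted to the sphere.
  refine ⟨fun ε x => mollify ε (collarExtension φ) x, ?_, ?_, C', ?_⟩
  · refine Eventually.of_forall fun ε => ?_
    have := Fact.mk (finrank_euclideanSpace_fin (𝕜 := ℝ) (n := k + 1))
    exact (contDiff_mollify (hH.continuous hσ) ε).contMDiff.comp
      (contMDiff_coe_sphere (n := k) (E := EuclideanSpace ℝ (Fin (k + 1))))
  · rw [Metric.tendstoUniformly_iff]
    intro η hη
    have hlim : Tendsto (fun ε : ℝ => (C' : ℝ) * ε ^ (σ : ℝ)) (𝓝[>] 0) (𝓝 0) := by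
      have h0 : ContinuousAt (fun ε : ℝ => (C' : ℝ) * ε ^ (σ : ℝ)) 0 :=
        continuousAt_const.mul (Real.continuousAt_rpow_const _ _ (Or.inr σ.2))
      have h1 := h0.tendsto
      simp only [Real.zero_rpow (NNReal.coe_pos.2 hσ).ne', mul_zero] at h1
      exact h1.mono_left nhdsWithin_le_nhds
    filter_upwards [hlim.eventually_lt_const hη, self_mem_nhdsWithin] with ε hε hε0 x
    rw [dist_comm, dist_eq_norm]
    have h := hH.norm_mollify_sub_self_le hσ hε0 (x : EuclideanSpace ℝ (Fin (k + 1)))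
    rw [collarExtension_coe] at h
    exact h.trans_lt hε
  · filter_upwards [self_mem_nhdsWithin] with ε hε x y
    exact (hH.mollify hσ hε) x y

/-- Hölder, sup and continuity bounds for the scalar functions entering the pullback, uniform over
bounded sets of Hölder maps. -/
lemma exists_coefficientTuple_bounds
    {w : EuclideanSpace ℝ (Fin N) → EuclideanSpace ℝ (Fin N) [⋀^Fin k]→L[ℝ] ℝ}
    (hw : ContDiff ℝ ∞ w) (I : Fin k → Fin N) (σ C R : ℝ≥0) :
    ∃ K C' R' : ℝ≥0, ∀ ψ : UnitSphere k → EuclideanSpace ℝ (Fin N), (∀ x, ‖ψ x‖ ≤ R) →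
      (HolderWith C σ ψ → ∀ i, HolderWith C' σ (coefficientTuple w I ψ i)) ∧
      (∀ i x, ‖coefficientTuple w I ψ i x‖ ≤ R') ∧
      ∀ ψ' : UnitSphere k → EuclideanSpace ℝ (Fin N), (∀ x, ‖ψ' x‖ ≤ R) →
        ∀ i x, ‖coefficientTuple w I ψ i x - coefficientTuple w I ψ' i x‖ ≤
          K * ‖ψ x - ψ' x‖ := by
  set a : EuclideanSpace ℝ (Fin N) → ℝ := fun z =>
    w z fun j => EuclideanSpace.single (I j) (1 : ℝ) with ha
  have haS : ContDiff ℝ ∞ a :=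
    (ContinuousAlternatingMap.apply ℝ (EuclideanSpace ℝ (Fin N)) ℝ
      (fun j => EuclideanSpace.single (I j) (1 : ℝ))).contDiff.comp hw
  obtain ⟨K, hK⟩ := ContDiffOn.exists_lipschitzOnWith
    (s := Metric.closedBall (0 : EuclideanSpace ℝ (Fin N)) R) haS.contDiffOn (by simp)
    (convex_closedBall _ _) (isCompact_closedBall _ _)
  obtain ⟨B, hB⟩ :=
    (isCompact_closedBall (0 : EuclideanSpace ℝ (Fin N)) R).exists_bound_of_continuousOn
    haS.continuous.continuousOn
  have hcoord : ∀ (z z' : EuclideanSpace ℝ (Fin N)) (m : Fin N), ‖z m - z' m‖ ≤ ‖z - z'‖ :=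
    fun z z' m => PiLp.norm_apply_le (z - z') m
  have hdiff : ∀ ψ : UnitSphere k → EuclideanSpace ℝ (Fin N), (∀ x, ‖ψ x‖ ≤ R) →
      ∀ ψ' : UnitSphere k → EuclideanSpace ℝ (Fin N), (∀ x, ‖ψ' x‖ ≤ R) →
      ∀ i x x', ‖coefficientTuple w I ψ i x - coefficientTuple w I ψ' i x'‖ ≤
          (K + 1) * ‖ψ x - ψ' x'‖ := by
    intro ψ hψ ψ' hψ' i x x'
    refine Fin.cases ?_ (fun l => ?_) i
    · have h := hK.dist_le_mul (ψ x) (by simpa using hψ x) (ψ' x') (by simpa using hψ' x')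
      rw [dist_eq_norm, dist_eq_norm] at h
      refine h.trans (mul_le_mul_of_nonneg_right (by linarith) (norm_nonneg _))
    · refine (hcoord (ψ x) (ψ' x') (I l)).trans (le_mul_of_one_le_left (norm_nonneg _) ?_)
      linarith [K.2]
  -- The coefficient `a` has Lipschitz constant `K` on the ball of radius `R` and each coordinate
  -- has constant `1`; `K + 1` covers both. The sup bounds `B` and `R` are added likewise.
  refine ⟨K + 1, (K + 1) * C, B.toNNReal + R, fun ψ hψ => ⟨fun hH i => ?_, fun i x => ?_,
    fun ψ' hψ' i x => hdiff ψ hψ ψ' hψ' i x x⟩⟩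
  · refine HolderWith.of_dist_le fun x y => ?_
    rw [dist_eq_norm]
    refine (hdiff ψ hψ ψ hψ i x y).trans ?_
    have h := hH.dist_le x y
    rw [dist_eq_norm] at h
    push_cast
    rw [mul_assoc]
    exact mul_le_mul_of_nonneg_left h (by positivity)
  · push_cast
    refine Fin.cases ?_ (fun l => ?_) i
    · exact ((hB (ψ x) (by simpa using hψ x)).trans (Real.le_coe_toNNReal B)).trans
        (le_add_of_nonneg_right R.2)
    · exact ((PiLp.norm_apply_le (ψ x) (I l)).trans (hψ x)).trans
        (le_add_of_nonneg_left (by positivity))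

/-- For each multi-index, the pairings attached to two smooth `C^σ`-approximations of the same map
approach each other. -/
lemma tendsto_jacPairing_sub {σ : ℝ≥0} (hσ : 0 < σ) (hσ1 : σ ≤ 1)
    (hγ : 0 < (σ : ℝ) + k * ((σ : ℝ) - 1))
    {φ : UnitSphere k → EuclideanSpace ℝ (Fin N)} (hφ : MemHolder σ φ)
    {w : EuclideanSpace ℝ (Fin N) → EuclideanSpace ℝ (Fin N) [⋀^Fin k]→L[ℝ] ℝ}
    (hw : ContDiff ℝ ∞ w) (I : Fin k → Fin N)
    {φ₁ φ₂ : ℝ → UnitSphere k → EuclideanSpace ℝ (Fin N)}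
    (h₁ : IsSmoothHolderApprox σ φ φ₁) (h₂ : IsSmoothHolderApprox σ φ φ₂) :
    Tendsto (fun p : ℝ × ℝ =>
      (jacPairing radialStep 0 fun i => collarExtension (coefficientTuple w I (φ₁ p.1) i)) -
      jacPairing radialStep 0 fun i => collarExtension (coefficientTuple w I (φ₂ p.2) i))
      (𝓝[>] 0 ×ˢ 𝓝[>] 0) (𝓝 0) := by
  obtain ⟨C₀, hC₀⟩ := hφ
  obtain ⟨R, hR⟩ := exists_norm_le_of_holderWith hσ hC₀
  obtain ⟨C₁, hC₁⟩ := h₁.bounded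
  obtain ⟨C₂, hC₂⟩ := h₂.bounded
  -- The radius `R + 1` contains the values of every map within distance one of `φ`.
  obtain ⟨K, C, B, hKCB⟩ := exists_coefficientTuple_bounds hw I σ (max C₁ C₂) (R + 1)
  obtain ⟨C', hC'⟩ := exists_holderWith_collarExtension k hσ1 C B
  rw [Metric.tendsto_nhds]
  intro η hη
  obtain ⟨δ, hδ, hJ⟩ := jacPairing_uniformContinuous_holder
    (contDiff_radialStep (k := k)) hasCompactSupport_radialStep 0 hσ hσ1 (by simpa using hγ) C'
    (half_pos hη)
  -- The `1` keeps the values in the ball of radius `R + 1`. The other bound puts the two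
  -- approximations within `δ / (K + 1)` of each other, hence their coefficient tuples within `δ`.
  have hδ' : 0 < min 1 (δ / (2 * (K + 1))) := by positivity
  have hu₁ := Metric.tendstoUniformly_iff.1 h₁.tendsto _ hδ'
  have hu₂ := Metric.tendstoUniformly_iff.1 h₂.tendsto _ hδ'
  have hadm : ∀ ψ : UnitSphere k → EuclideanSpace ℝ (Fin N),
      ContMDiff (𝓡 k) 𝓘(ℝ, EuclideanSpace ℝ (Fin N)) ∞ ψ → HolderWith (max C₁ C₂) σ ψ →
      (∀ x, ‖ψ x‖ ≤ (R + 1 : ℝ≥0)) →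
      (∀ i, ContDiff ℝ ∞ (collarExtension (coefficientTuple w I ψ i))) ∧
      (∃ K, ∀ i, LipschitzWith K (collarExtension (coefficientTuple w I ψ i))) ∧
      ∀ i, HolderWith C' σ (collarExtension (coefficientTuple w I ψ i)) := by
    intro ψ hψ hH hb
    refine ⟨fun i => contDiff_collarExtension (contMDiff_coefficientTuple hw I hψ i), ?_,
      fun i => hC' _ ((hKCB ψ hb).1 hH i) ((hKCB ψ hb).2.1 i)⟩
    choose L hL using fun i =>
      exists_lipschitzWith_collarExtension (contMDiff_coefficientTuple hw I hψ i)
    exact ⟨∑ i, L i, fun i => (hL i).weaken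
      (Finset.single_le_sum (f := L) (fun _ _ => zero_le) (Finset.mem_univ i))⟩
  have hbound : ∀ ψ : UnitSphere k → EuclideanSpace ℝ (Fin N),
      (∀ x, dist (φ x) (ψ x) < min 1 (δ / (2 * (K + 1)))) →
      ∀ x, ‖ψ x‖ ≤ (R + 1 : ℝ≥0) := by
    intro ψ hψ x
    have h1 := (hψ x).trans_le (min_le_left _ _)
    rw [dist_comm, dist_eq_norm] at h1
    have h2 := norm_le_norm_add_norm_sub' (ψ x) (φ x)
    push_cast
    linarith [hR x]
  filter_upwards [(h₁.smooth.and (hC₁.and hu₁)).prod_mk (h₂.smooth.and (hC₂.and hu₂))]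
    with p hp
  obtain ⟨⟨hs₁, hH₁, hd₁⟩, hs₂, hH₂, hd₂⟩ := hp
  have hb₁ := hbound _ hd₁
  have hb₂ := hbound _ hd₂
  obtain ⟨a1, a2, a3⟩ := hadm _ hs₁ (hH₁.mono (le_max_left _ _)) hb₁
  obtain ⟨b1, b2, b3⟩ := hadm _ hs₂ (hH₂.mono (le_max_right _ _)) hb₂
  have hfin := hJ _ _ a1 a2 a3 b1 b2 b3 fun i y => ?_
  · rw [Real.dist_eq, sub_zero]
    exact hfin.trans_lt (half_lt_self hη)
  · refine norm_collarExtension_sub_le (V := ℝ) hδ.le (fun x => ?_) y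
    refine ((hKCB _ hb₁).2.2 _ hb₂ i x).trans ?_
    have e1 := (hd₁ x).trans_le (min_le_right _ _)
    have e2 := (hd₂ x).trans_le (min_le_right _ _)
    rw [dist_comm] at e1
    have e3 : ‖φ₁ p.1 x - φ₂ p.2 x‖ ≤ δ / (K + 1) := by
      rw [← dist_eq_norm]
      refine (dist_triangle _ (φ x) _).trans ((add_le_add e1.le e2.le).trans (le_of_eq ?_))
      field_simp
      norm_num
    calc (K : ℝ) * ‖φ₁ p.1 x - φ₂ p.2 x‖ ≤ K * (δ / (K + 1)) :=
          mul_le_mul_of_nonneg_left e3 K.2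
      _ = δ * (K / (K + 1)) := by ring
      _ ≤ δ := mul_le_of_le_one_right hδ.le
          ((div_le_one (by positivity)).2 (by linarith))

/-- The pullback integrals of two smooth `C^σ`-approximations of the same map approach each
other. -/
lemma tendsto_spherePullbackIntegral_sub {σ : ℝ≥0} (hσ : 0 < σ) (hσ1 : σ ≤ 1)
    (hγ : 0 < (σ : ℝ) + k * ((σ : ℝ) - 1))
    {φ : UnitSphere k → EuclideanSpace ℝ (Fin N)} (hφ : MemHolder σ φ)
    {w : EuclideanSpace ℝ (Fin N) → EuclideanSpace ℝ (Fin N) [⋀^Fin k]→L[ℝ] ℝ}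
    (hw : ContDiff ℝ ∞ w) {φ₁ φ₂ : ℝ → UnitSphere k → EuclideanSpace ℝ (Fin N)}
    (h₁ : IsSmoothHolderApprox σ φ φ₁) (h₂ : IsSmoothHolderApprox σ φ φ₂) :
    Tendsto (fun p : ℝ × ℝ =>
      spherePullbackIntegral (φ₁ p.1) w - spherePullbackIntegral (φ₂ p.2) w)
      (𝓝[>] 0 ×ˢ 𝓝[>] 0) (𝓝 0) := by
  have h := (tendsto_finsetSum (Finset.univ : Finset (Fin k → Fin N)) fun I _ =>
    tendsto_jacPairing_sub hσ hσ1 hγ hφ hw I h₁ h₂).const_mul (-(k.factorial : ℝ)⁻¹)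
  rw [Finset.sum_const_zero, mul_zero] at h
  refine h.congr' ?_
  filter_upwards [h₁.smooth.prod_mk h₂.smooth] with p hp
  rw [spherePullbackIntegral_eq_sum_jacPairing hw hp.1,
    spherePullbackIntegral_eq_sum_jacPairing hw hp.2, ← mul_sub, Finset.sum_sub_distrib]

end HolderApproximation

theorem mainTheorem7 (k N : ℕ) (σ : ℝ≥0) (hσ : (k : ℝ) / (k + 1) < σ) (hσ_le : σ ≤ 1)
    (φ : UnitSphere k → EuclideanSpace ℝ (Fin N)) (hφ : MemHolder σ φ)
    (w : EuclideanSpace ℝ (Fin N) → EuclideanSpace ℝ (Fin N) [⋀^Fin k]→L[ℝ] ℝ)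
    (hw : ContDiff ℝ ∞ w) :
    (∃ φε : ℝ → UnitSphere k → EuclideanSpace ℝ (Fin N), IsSmoothHolderApprox σ φ φε) ∧
    ∃ L : ℝ, ∀ φε : ℝ → UnitSphere k → EuclideanSpace ℝ (Fin N),
      IsSmoothHolderApprox σ φ φε →
        Tendsto (fun ε => spherePullbackIntegral (φε ε) w) (𝓝[>] (0 : ℝ)) (𝓝 L) := by
  have hσ0 : 0 < σ := by
    rw [← NNReal.coe_pos]
    exact lt_of_le_of_lt (by positivity) hσ
  have hγ : 0 < (σ : ℝ) + k * ((σ : ℝ) - 1) := by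
    rw [div_lt_iff₀ (by positivity)] at hσ
    linarith
  obtain ⟨φ₀, h₀⟩ := exists_isSmoothHolderApprox hσ0 hσ_le hφ
  refine ⟨⟨φ₀, h₀⟩, ?_⟩
  -- Comparing `φ₀` with itself at two independent parameters is the Cauchy criterion.
  have hcauchy : Cauchy (map (fun ε => spherePullbackIntegral (φ₀ ε) w) (𝓝[>] (0 : ℝ))) := by
    rw [cauchy_map_iff]
    refine ⟨inferInstance, ?_⟩
    rw [tendsto_uniformity_iff_dist_tendsto_zero]
    simpa [Real.dist_eq] using (tendsto_spherePullbackIntegral_sub hσ0 hσ_le hγ hφ hw h₀ h₀).abs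
  obtain ⟨L, hL⟩ := CompleteSpace.complete hcauchy
  refine ⟨L, fun φε hφε => ?_⟩
  -- On the diagonal, the same comparison transfers the limit from `φ₀` to any other approximation.
  have hdiff := (tendsto_spherePullbackIntegral_sub hσ0 hσ_le hγ hφ hw hφε h₀).comp
    (tendsto_id.prodMk tendsto_id)
  have hL' : Tendsto (fun ε => spherePullbackIntegral (φ₀ ε) w) (𝓝[>] (0 : ℝ)) (𝓝 L) := hL
  simpa using hdiff.add hL'
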